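/- Let $m\ge 0$ be an integer. Let $\gamma:[-1,1]\times[0,T)\to\mathbb R^2$, $\gamma(\cdot,0)=\gamma_0$, be a one-parameter family of smooth regular curves, with unit tangent $\tau=\gamma_s$ ($s$ is arclength along $\gamma(\cdot,t)$), unit normal $\nu$ ($\tau$ rotated by $\pi/2$) and curvature $k=\langle\gamma_{ss},\nu\rangle$; write $k_{s^j}$ for the $j$-th arclength derivative of $k$. Suppose that $\gamma$ is smooth on $[-1,1]\times(0,T)$, that its $x$-derivatives of order at most $m+2$ are continuous on $[-1,1]\times[0,T)$, and that for $0<t<T$ it solves the $L^2$-gradient flow of $\int_\gamma k_{s^m}^2\,ds$, $$\frac{\partial\gamma}{\partial t}=\Big[(-1)^{m+1}k_{s^{2m+2}}-\sum_{j=1}^m(-1)^j\,k\,k_{s^{m+j}}k_{s^{m-j}}-\tfrac12\,k\,k_{s^m}^2\Big]\nu ,$$ with the generalised Neumann boundary conditions: for $0\le t<T$ the ends $\gamma(-1,t)$ and $\gamma(1,t)$ lie on two fixed distinct parallel lines $\eta_-$ and $\eta_+$ respectively, the curve meets these lines orthogonally there, and $k_{s^{2i+1}}(\pm1,t)=0$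 for $i=0,\dots,m$. Suppose also that $\gamma_0$ has winding number $\frac1{2\pi}\int_{\gamma_0}k\,ds=0$. Then there is $\varepsilon>0$ depending only on $m$ such that if the scale-invariant initial energy satisfies $$L[\gamma_0]^{2m+1}\int_{\gamma_0}k_{s^m}^2\,ds\le\varepsilon ,$$ where $L$ denotes length, then $t\mapsto L[\gamma(\cdot,t)]$ is nonincreasing on $[0,T)$. -/

import Mathlib

open scoped ContDiff

noncomputable section

namespace PlaneCurve

/-- The parameter interval of the curves. The plane is `ℂ`, with its Euclidean norm and
real inner product. -/
def paramInterval : Set ℝ := Set.Icc (-1) 1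

/-- The parameter derivative on `[-1, 1]` (one-sided at the ends). -/
def paramDeriv {E : Type*} [NormedAddCommGroup E] [NormedSpace ℝ E] (f : ℝ → E) : ℝ → E :=
  derivWithin f paramInterval

/-- Differentiation by arclength along the curve `c`: `f_s = f_x / |c_x|`. -/
def arcDeriv {E : Type*} [NormedAddCommGroup E] [NormedSpace ℝ E]
    (c : ℝ → ℂ) (f : ℝ → E) : ℝ → E :=
  fun x => ‖paramDeriv c x‖⁻¹ • paramDeriv f x

/-- Unit tangent `τ = c_s`. -/
def tangent (c : ℝ → ℂ) : ℝ → ℂ := arcDeriv c c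

/-- Unit normal: the tangent rotated by `π / 2`. -/
def normal (c : ℝ → ℂ) : ℝ → ℂ := fun x => Complex.I * tangent c x

/-- Scalar curvature with respect to `normal c`: `k = ⟨c_ss, ν⟩`. Reversing the choice of `ν`
changes the sign of `k`, and changes neither the energy nor the flow below. -/
def curvature (c : ℝ → ℂ) : ℝ → ℝ :=
  fun x => inner ℝ (arcDeriv c (tangent c) x) (normal c x)

/-- The `j`-th iterated arclength derivative of the curvature. -/
def curvatureDeriv (c : ℝ → ℂ) (j : ℕ) : ℝ → ℝ := (arcDeriv c)^[j] (curvature c)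

/-- `∫_c f ds`. -/
def arcIntegral (c : ℝ → ℂ) (f : ℝ → ℝ) : ℝ :=
  ∫ x in (-1 : ℝ)..1, f x * ‖paramDeriv c x‖

/-- Length of the curve. -/
def length (c : ℝ → ℂ) : ℝ := arcIntegral c (fun _ => 1)

/-- The energy `∫ (k_{s^m})² ds`. -/
def energy (m : ℕ) (c : ℝ → ℂ) : ℝ := arcIntegral c (fun x => curvatureDeriv c m x ^ 2)

/-- The winding number `(1 / 2π) ∫ k ds`. -/
def windingNumber (c : ℝ → ℂ) : ℝ := (1 / (2 * Real.pi)) * arcIntegral c (curvature c)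

/-- The normal speed of the flow, minus the `L²`-gradient of `½ ∫ (k_{s^m})² ds`. -/
def gradSpeed (m : ℕ) (c : ℝ → ℂ) (x : ℝ) : ℝ :=
  (-1) ^ (m + 1) * curvatureDeriv c (2 * m + 2) x
    - ∑ j ∈ Finset.Icc 1 m,
        (-1) ^ j * (curvature c x * curvatureDeriv c (m + j) x * curvatureDeriv c (m - j) x)
    - (1 / 2) * curvature c x * curvatureDeriv c m x ^ 2

/-- A smooth regular solution `γ t x`, `t ∈ [0, T)`, `x ∈ [-1, 1]`, of the `L²`-gradient flow of
`∫ (k_{s^m})² ds`, with generalised Neumann boundary conditions on the two distinct parallel lines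
`{p | ⟨p, e⟩ = a}` (for the end `x = -1`) and `{p | ⟨p, e⟩ = b}` (for the end `x = 1`).
The solution is smooth for positive times and attains its smooth initial curve `γ 0` in `C^{m+2}`,
the order of differentiation in the energy. -/
structure IsGradientFlow (m : ℕ) (e : ℂ) (a b T : ℝ) (γ : ℝ → ℝ → ℂ) : Prop where
  norm_e : ‖e‖ = 1
  lines : a < b
  smooth_initial : ContDiffOn ℝ ∞ (γ 0) paramInterval
  smooth : ContDiffOn ℝ ∞ (fun p : ℝ × ℝ => γ p.1 p.2) (Set.Ioo 0 T ×ˢ paramInterval)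
  attains_initial : ∀ j ≤ m + 2, ContinuousOn
    (fun p : ℝ × ℝ => iteratedDerivWithin j (γ p.1) paramInterval p.2)
    (Set.Ico 0 T ×ˢ paramInterval)
  regular : ∀ t ∈ Set.Ico 0 T, ∀ x ∈ paramInterval, paramDeriv (γ t) x ≠ 0
  /-- The ends stay on the supporting lines. -/
  left_end : ∀ t ∈ Set.Ico 0 T, inner ℝ (γ t (-1)) e = a
  right_end : ∀ t ∈ Set.Ico 0 T, inner ℝ (γ t 1) e = b
  /-- The curve meets the supporting lines orthogonally: `⟨ν, e⟩ = 0` at both ends. -/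
  neumann : ∀ t ∈ Set.Ico 0 T, ∀ x ∈ ({-1, 1} : Set ℝ), inner ℝ (normal (γ t) x) e = 0
  /-- The odd arclength derivatives of `k` of order `1, 3, …, 2m + 1` vanish at both ends. -/
  odd_curvature : ∀ t ∈ Set.Ico 0 T, ∀ x ∈ ({-1, 1} : Set ℝ), ∀ i ≤ m,
    curvatureDeriv (γ t) (2 * i + 1) x = 0
  flow : ∀ t ∈ Set.Ioo 0 T, ∀ x ∈ paramInterval,
    HasDerivAt (fun τ => γ τ x) (gradSpeed m (γ t) x • normal (γ t) x) t

end PlaneCurve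

end

/-! Write F for the normal speed, L for length, E for the energy. Length satisfies L' = -∫ k F ds,
and integration by parts gives ∫ k F ds = ∫ k_{s^{m+1}}² ds plus terms quartic in k
(`length_variation`). On curves with ∫ k ds = 0 every k_{s^i}, i ≤ m, has a zero, so Poincaré
inequalities bound the quartic terms by C L^{2m+1} E ∫ k_{s^{m+1}}² ds with C = `lengthConst m`
(`quartic_bound_iterate`). Hence L' ≤ 0 while C L^{2m+1} E ≤ 1.

This smallness persists: E' = -2 ∫ F² ds ≤ 0 (`energy_variation`), so L^{2m+1} E cannot grow while
it is small, and a first-bad-time argument closes the loop (`antitoneOn_of_small`). The condition ∫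
k ds = 0 persists because the time derivative of k ds is F_ss ds and F_s = 0 at the ends.

Boundary terms are handled by parity. Smooth functions on space-time form an algebra with
derivations D = ∂_s and P = ∂_t, and the functions vanishing at both ends form an ideal J. To the
needed order k is even about the ends; time derivatives of the boundary conditions make F even too
(`hasParity_speed`). Each boundary term is then odd, so it lies in J. The estimates hold for t > 0;
continuity of L, E and ∫ k ds at t = 0 brings in the initial data. -/

noncomputable section
namespace PlaneCurve

/-! ### The algebra of smooth functions on space-time and its derivations. -/

/-- The space-time domain of a flow, for positive times. -/
def slab (T : ℝ) : Set (ℝ × ℝ) := Set.Ioo 0 T ×ˢ paramInterval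

theorem uniqueDiffOn_paramInterval : UniqueDiffOn ℝ paramInterval :=
  uniqueDiffOn_Icc (by norm_num)

theorem uniqueDiffOn_slab (T : ℝ) : UniqueDiffOn ℝ (slab T) :=
  (uniqueDiffOn_Ioo 0 T).prod uniqueDiffOn_paramInterval

/-- Needed for the symmetry of second derivatives at the ends of the curves, which are boundary
points of the slab. -/
theorem slab_subset_closure_interior (T : ℝ) : slab T ⊆ closure (interior (slab T)) := by
  rw [slab, interior_prod_eq, closure_prod_eq, isOpen_Ioo.interior_eq, paramInterval,
    interior_Icc, closure_Ioo (a := (-1 : ℝ)) (by norm_num)]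
  exact Set.prod_mono subset_closure le_rfl

/-- The algebra of real functions on the slab that are smooth up to the boundary. -/
def smoothFun (T : ℝ) : Subalgebra ℝ (slab T → ℝ) where
  carrier := {f | ∃ g : ℝ × ℝ → ℝ, ContDiffOn ℝ ∞ g (slab T) ∧ ∀ p : slab T, f p = g p}
  mul_mem' := by
    rintro f f' ⟨g, hg, h⟩ ⟨g', hg', h'⟩
    exact ⟨g * g', hg.mul hg', fun p => by simp [h, h']⟩
  add_mem' := by
    rintro f f' ⟨g, hg, h⟩ ⟨g', hg', h'⟩
    exact ⟨g + g', hg.add hg', fun p => by simp [h, h']⟩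
  algebraMap_mem' r := ⟨fun _ => r, contDiffOn_const, fun p => rfl⟩

variable {T : ℝ}

open Classical in
/-- Extension by zero of a smooth function on the slab. -/
def ext (f : smoothFun T) (p : ℝ × ℝ) : ℝ := if h : p ∈ slab T then f.1 ⟨p, h⟩ else 0

theorem ext_apply (f : smoothFun T) {p : ℝ × ℝ} (h : p ∈ slab T) : ext f p = f.1 ⟨p, h⟩ := by
  simp [ext, h]

theorem ext_coe (f : smoothFun T) (p : slab T) : ext f p = f.1 p := ext_apply f p.2

theorem contDiffOn_ext (f : smoothFun T) : ContDiffOn ℝ ∞ (ext f) (slab T) := by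
  obtain ⟨g, hg, h⟩ := f.2
  exact hg.congr fun p hp => by rw [ext_apply f hp, h]

theorem smoothFun_eq {f g : smoothFun T} (h : ∀ p ∈ slab T, ext f p = ext g p) : f = g := by
  apply Subtype.ext
  funext p
  rw [← ext_coe, ← ext_coe, h p p.2]

@[simp] theorem ext_add (f g : smoothFun T) (p : ℝ × ℝ) : ext (f + g) p = ext f p + ext g p := by
  by_cases h : p ∈ slab T <;> simp [ext, h]

@[simp] theorem ext_neg (f : smoothFun T) (p : ℝ × ℝ) : ext (-f) p = -ext f p := by
  by_cases h : p ∈ slab T <;> simp [ext, h]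

@[simp] theorem ext_sub (f g : smoothFun T) (p : ℝ × ℝ) : ext (f - g) p = ext f p - ext g p := by
  by_cases h : p ∈ slab T <;> simp [ext, h]

@[simp] theorem ext_mul (f g : smoothFun T) (p : ℝ × ℝ) : ext (f * g) p = ext f p * ext g p := by
  by_cases h : p ∈ slab T <;> simp [ext, h]

@[simp] theorem ext_smul (r : ℝ) (f : smoothFun T) (p : ℝ × ℝ) : ext (r • f) p = r * ext f p := by
  by_cases h : p ∈ slab T <;> simp [ext, h]

@[simp] theorem ext_zero (p : ℝ × ℝ) : ext (0 : smoothFun T) p = 0 := by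
  by_cases h : p ∈ slab T <;> simp [ext, h]

-- The case `n = 0` forces `p` to lie in the slab: outside it the extension of 1 is 0, whereas a
-- zeroth power is 1.
@[simp] theorem ext_pow (f : smoothFun T) {p : ℝ × ℝ} (hp : p ∈ slab T) (n : ℕ) :
    ext (f ^ n) p = ext f p ^ n := by
  simp [ext, hp]

theorem ext_one {p : ℝ × ℝ} (hp : p ∈ slab T) : ext (1 : smoothFun T) p = 1 := by
  simp [ext, hp]

@[simp] theorem ext_sum {ι : Type*} (s : Finset ι) (f : ι → smoothFun T) (p : ℝ × ℝ) :
    ext (∑ i ∈ s, f i) p = ∑ i ∈ s, ext (f i) p := by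
  classical
  induction s using Finset.induction_on with
  | empty => simp
  | insert a s ha ih => rw [Finset.sum_insert ha, Finset.sum_insert ha, ext_add, ih]

/-- The smooth function on the slab with the given values. -/
def ofContDiffOn (g : ℝ × ℝ → ℝ) (hg : ContDiffOn ℝ ∞ g (slab T)) : smoothFun T :=
  ⟨fun p => g p, g, hg, fun _ => rfl⟩

theorem ext_ofContDiffOn {g : ℝ × ℝ → ℝ} (hg : ContDiffOn ℝ ∞ g (slab T)) {p : ℝ × ℝ}
    (hp : p ∈ slab T) : ext (ofContDiffOn g hg) p = g p := by
  rw [ext_apply _ hp]; rfl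

theorem contDiffOn_dirDeriv (w : ℝ × ℝ) (f : smoothFun T) :
    ContDiffOn ℝ ∞ (fun p => fderivWithin ℝ (ext f) (slab T) p w) (slab T) :=
  ((contDiffOn_ext f).fderivWithin (uniqueDiffOn_slab T) (by simp)).clm_apply contDiffOn_const

theorem differentiableWithinAt_ext (f : smoothFun T) {p : ℝ × ℝ} (hp : p ∈ slab T) :
    DifferentiableWithinAt ℝ (ext f) (slab T) p :=
  (contDiffOn_ext f).differentiableOn (by simp) p hp

/-- The derivative in the direction `w`, as a derivation of the algebra of smooth functions. -/
def dirDeriv (w : ℝ × ℝ) : Derivation ℝ (smoothFun T) (smoothFun T) :=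
  Derivation.mk'
    { toFun := fun f => ofContDiffOn _ (contDiffOn_dirDeriv w f)
      map_add' := fun f g => smoothFun_eq fun p hp => by
        have : ext (f + g) = ext f + ext g := by funext p; simp
        rw [ext_add, ext_ofContDiffOn _ hp, ext_ofContDiffOn _ hp, ext_ofContDiffOn _ hp, this,
          fderivWithin_add (uniqueDiffOn_slab T p hp) (differentiableWithinAt_ext f hp)
            (differentiableWithinAt_ext g hp)]
        rfl
      map_smul' := fun r f => smoothFun_eq fun p hp => by
        have : ext (r • f) = r • ext f := by funext p; simp
        rw [RingHom.id_apply, ext_smul, ext_ofContDiffOn _ hp, ext_ofContDiffOn _ hp, this,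
          fderivWithin_const_smul (uniqueDiffOn_slab T p hp) (differentiableWithinAt_ext f hp)]
        rfl }
    fun f g => smoothFun_eq fun p hp => by
      have : ext (f * g) = ext f * ext g := by funext p; simp
      simp only [LinearMap.coe_mk, AddHom.coe_mk, smul_eq_mul, ext_add, ext_mul]
      rw [ext_ofContDiffOn _ hp, ext_ofContDiffOn _ hp, ext_ofContDiffOn _ hp, this,
          fderivWithin_mul (uniqueDiffOn_slab T p hp) (differentiableWithinAt_ext f hp)
            (differentiableWithinAt_ext g hp)]
      simp

theorem ext_dirDeriv (w : ℝ × ℝ) (f : smoothFun T) {p : ℝ × ℝ} (hp : p ∈ slab T) :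
    ext (dirDeriv w f) p = fderivWithin ℝ (ext f) (slab T) p w :=
  ext_ofContDiffOn (contDiffOn_dirDeriv w f) hp

theorem dirDeriv_comm (w w' : ℝ × ℝ) (f : smoothFun T) :
    dirDeriv w (dirDeriv w' f) = dirDeriv w' (dirDeriv w f) := by
  refine smoothFun_eq fun p hp => ?_
  -- The direction `u'` is constant, so both iterated derivatives are values of one second
  -- derivative, which is symmetric.
  have key : ∀ u u' : ℝ × ℝ, ext (dirDeriv u (dirDeriv u' f)) p =
      fderivWithin ℝ (fderivWithin ℝ (ext f) (slab T)) (slab T) p u u' := by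
    intro u u'
    rw [ext_dirDeriv _ _ hp, fderivWithin_congr (fun q hq => ext_dirDeriv u' f hq)
      (ext_dirDeriv u' f hp)]
    have hd : DifferentiableWithinAt ℝ (fderivWithin ℝ (ext f) (slab T)) (slab T) p :=
      ((contDiffOn_ext f).fderivWithin (m := ∞) (uniqueDiffOn_slab T) (by simp)).differentiableOn
        (by simp) p hp
    rw [fderivWithin_clm_apply (uniqueDiffOn_slab T p hp) hd (differentiableWithinAt_const _)]
    simp
  rw [key, key]
  exact ((contDiffOn_ext f) p hp).isSymmSndFDerivWithinAt (by
      rw [minSmoothness_of_isRCLikeNormedField]; exact WithTop.coe_le_coe.2 (le_top (a := (2 : ℕ∞))))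
    (uniqueDiffOn_slab T) (slab_subset_closure_interior T hp) hp w w'

/-- The time derivative. -/
abbrev timeDeriv : Derivation ℝ (smoothFun T) (smoothFun T) := dirDeriv (1, 0)

/-- The derivative in the parameter of the curves. -/
abbrev spaceDeriv : Derivation ℝ (smoothFun T) (smoothFun T) := dirDeriv (0, 1)

theorem hasDerivAt_time (f : smoothFun T) {t x : ℝ} (ht : t ∈ Set.Ioo 0 T)
    (hx : x ∈ paramInterval) :
    HasDerivAt (fun τ => ext f (τ, x)) (ext (timeDeriv f) (t, x)) t := by
  have hp : (t, x) ∈ slab T := ⟨ht, hx⟩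
  rw [ext_dirDeriv _ _ hp]
  have h1 : HasDerivWithinAt (fun τ : ℝ => (τ, x)) ((1 : ℝ), (0 : ℝ)) (Set.Ioo 0 T) t :=
    ((hasDerivAt_id t).prodMk (hasDerivAt_const t x)).hasDerivWithinAt
  have h2 := (differentiableWithinAt_ext f hp).hasFDerivWithinAt.comp_hasDerivWithinAt t h1
    (fun τ hτ => show (τ, x) ∈ slab T from ⟨hτ, hx⟩)
  exact h2.hasDerivAt (Ioo_mem_nhds ht.1 ht.2)

theorem hasDerivWithinAt_space (f : smoothFun T) {t x : ℝ} (ht : t ∈ Set.Ioo 0 T)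
    (hx : x ∈ paramInterval) :
    HasDerivWithinAt (fun y => ext f (t, y)) (ext (spaceDeriv f) (t, x)) paramInterval x := by
  have hp : (t, x) ∈ slab T := ⟨ht, hx⟩
  rw [ext_dirDeriv _ _ hp]
  have h1 : HasDerivWithinAt (fun y : ℝ => (t, y)) ((0 : ℝ), (1 : ℝ)) paramInterval x :=
    ((hasDerivAt_const x t).prodMk (hasDerivAt_id x)).hasDerivWithinAt
  exact (differentiableWithinAt_ext f hp).hasFDerivWithinAt.comp_hasDerivWithinAt x h1
    (fun y hy => show (t, y) ∈ slab T from ⟨ht, hy⟩)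

end PlaneCurve

end

noncomputable section
namespace PlaneCurve

/-! ### Parity at the ends and integration by parts. -/

section Parity

variable {A : Type*} [CommRing A] [Algebra ℝ A] (D : Derivation ℝ A A) (J : Ideal A)

/-- The derivatives `D^i f` with `i ≤ N` and `i + p` odd lie in the ideal `J`: to order `N`, the
function `f` is even (`p` even) or odd (`p` odd) about the zero set of `J`. -/
def HasParity (N p : ℕ) (f : A) : Prop := ∀ i ≤ N, Odd (i + p) → D^[i] f ∈ J

variable {D J} {N N' p q : ℕ} {f g : A}

theorem HasParity.mono (h : HasParity D J N p f) (hN : N' ≤ N) : HasParity D J N' p f :=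
  fun i hi => h i (hi.trans hN)

theorem HasParity.congr (h : HasParity D J N p f) (hpq : Even (p + q)) : HasParity D J N q f :=
  fun i hi ho => h i hi (by grind)

theorem HasParity.deriv (h : HasParity D J (N + 1) p f) : HasParity D J N (p + 1) (D f) := by
  intro i hi ho
  rw [← Function.iterate_succ_apply]
  exact h (i + 1) (by omega) (by grind)

theorem HasParity.iterate {j : ℕ} (h : HasParity D J (N + j) p f) :
    HasParity D J N (p + j) (D^[j] f) := by
  intro i hi ho
  rw [← Function.iterate_add_apply]
  exact h (i + j) (by omega) (by grind)

/-- If `p + q` is odd, one of the two factors is odd and lies in the ideal. Higher orders follow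
from the Leibniz rule by induction on `N`. -/
theorem HasParity.mul (hf : HasParity D J N p f) (hg : HasParity D J N q g) :
    HasParity D J N (p + q) (f * g) := by
  induction N generalizing p q f g with
  | zero =>
    intro i hi ho
    obtain rfl : i = 0 := by omega
    rcases Nat.even_or_odd p with hp | hp
    · exact J.mul_mem_left _ (hg 0 le_rfl (by grind))
    · exact J.mul_mem_right _ (hf 0 le_rfl (by grind))
  | succ N ih =>
    intro i hi ho
    rcases i with _ | i
    · rcases Nat.even_or_odd p with hp | hp
      · exact J.mul_mem_left _ (hg 0 (by omega) (by grind))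
      · exact J.mul_mem_right _ (hf 0 (by omega) (by grind))
    · rw [Function.iterate_succ_apply, D.leibniz, smul_eq_mul, smul_eq_mul, iterate_map_add]
      exact J.add_mem (ih (hf.mono (by omega)) hg.deriv i (by omega) (by grind))
        (ih (hg.mono (by omega)) hf.deriv i (by omega) (by grind))

/-- Iterated integration by parts, the boundary terms vanishing by parity. -/
theorem HasParity.integral_iterate_mul {I : A →ₗ[ℝ] ℝ} (hI : ∀ f ∈ J, I (D f) = 0) {j : ℕ}
    (hf : HasParity D J N p f) (hg : HasParity D J N q g) (hj : j ≤ N + 1)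
    (hpq : Even (p + q + j)) : I (D^[j] f * g) = (-1) ^ j * I (f * D^[j] g) := by
  induction j generalizing q g N with
  | zero => simp
  | succ j ih =>
    rcases j with _ | j
    · have h0 : f * g ∈ J := by
        have := (hf.mul hg) 0 (Nat.zero_le _) (by grind)
        simpa using this
      have h1 := hI _ h0
      rw [D.leibniz, map_add, smul_eq_mul, smul_eq_mul] at h1
      simp only [zero_add, Function.iterate_one, pow_one]
      rw [mul_comm (D f) g]
      linarith
    · obtain ⟨M, rfl⟩ : ∃ M, N = M + 1 := ⟨N - 1, by omega⟩
      -- Boundary term of one integration by parts: its parity `p + q + j + 1` is odd. The remaining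
      -- `j + 1` derivatives are moved by induction, with `D g` in place of `g`.
      have h0 : D^[j + 1] f * g ∈ J := by
        have h2 : HasParity D J 0 (p + (j + 1)) (D^[j + 1] f) :=
          HasParity.iterate (hf.mono (by omega))
        have := (h2.mul (hg.mono (Nat.zero_le _))) 0 (Nat.zero_le _) (by grind)
        simpa using this
      have h1 := hI _ h0
      rw [D.leibniz, map_add, smul_eq_mul, smul_eq_mul,
        ih (hf.mono (Nat.le_succ M)) hg.deriv (by omega) (by grind)] at h1
      rw [Function.iterate_succ_apply' (f := D) (n := j + 1), mul_comm, ← sub_eq_zero,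
        Function.iterate_succ_apply (f := D) (n := j + 1) (x := g)]
      rw [pow_succ]
      linarith

end Parity

/-! ### Parity of the normal speed and first variation of the energy. -/

section Evolution

variable {A : Type*} [CommRing A] [Algebra ℝ A] {D P : Derivation ℝ A A} {J : Ideal A}
  {k F : A} {m : ℕ}

/-- Each exchange of `P` with one `D` leaves a commutator term `k * F * D`, which is then hit by the
derivatives standing to its left. -/
theorem evolution_iterate (hc : ∀ f, P (D f) = D (P f) + k * F * D f) (n : ℕ) (f : A) :
    P (D^[n] f) = D^[n] (P f) + ∑ j ∈ Finset.range n, D^[j] (k * F * D^[n - j] f) := by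
  induction n generalizing f with
  | zero => simp
  | succ n ih =>
    rw [Function.iterate_succ_apply, ih, hc, iterate_map_add, Finset.sum_range_succ,
      Function.iterate_succ_apply]
    have : ∀ j ∈ Finset.range n, D^[j] (k * F * D^[n - j] (D f)) =
        D^[j] (k * F * D^[n + 1 - j] f) := by
      intro j hj
      rw [← Function.iterate_succ_apply, Nat.succ_sub (by grind)]
    rw [Finset.sum_congr rfl this]
    simp only [Nat.add_sub_cancel_left, Function.iterate_one]
    ring

theorem hasParity_curvature (hk : ∀ i ≤ m, D^[2 * i + 1] k ∈ J) : HasParity D J (2 * m + 1) 0 k := by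
  intro i hi ho
  obtain ⟨j, rfl⟩ : Odd i := by simpa using ho
  exact hk j (by omega)

/-- The normal speed inherits the parity of the curvature from the boundary conditions. -/
theorem hasParity_speed (hc : ∀ f, P (D f) = D (P f) + k * F * D f)
    (hPk : P k = D (D F) + k ^ 2 * F) (hPJ : ∀ f ∈ J, P f ∈ J) (hF : D F ∈ J)
    (hk : ∀ i ≤ m, D^[2 * i + 1] k ∈ J) (i : ℕ) (hi : i ≤ m + 1) :
    HasParity D J (2 * i + 1) 0 F := by
  induction i with
  | zero =>
    intro i hi ho
    obtain rfl : i = 1 := by grind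
    exact hF
  | succ i ih =>
    have hFi := ih (by omega)
    have hkp : HasParity D J (2 * i + 1) 0 k := (hasParity_curvature hk).mono (by omega)
    intro l hl ho
    by_cases hl' : l ≤ 2 * i + 1
    · exact hFi l hl' ho
    obtain rfl : l = 2 * i + 1 + 2 := by grind
    -- The time derivative of k_{s^{2i+1}} = 0 is F_{s^{2i+3}} plus terms that contain F only up to
    -- order 2i+1. Those are odd by induction, so F_{s^{2i+3}} vanishes at the ends too.
    have h := hPJ _ (hk i (by omega))
    rw [evolution_iterate hc, hPk, iterate_map_add] at h
    have h1 : D^[2 * i + 1] (k ^ 2 * F) ∈ J := by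
      have := (hkp.mul hkp).mul hFi (2 * i + 1) le_rfl (by grind)
      rwa [← pow_two] at this
    have h2 : ∑ j ∈ Finset.range (2 * i + 1), D^[j] (k * F * D^[2 * i + 1 - j] k) ∈ J := by
      refine J.sum_mem fun j hj => ?_
      have hj' : j < 2 * i + 1 := Finset.mem_range.1 hj
      have hkj : HasParity D J j (0 + (2 * i + 1 - j)) (D^[2 * i + 1 - j] k) :=
        HasParity.iterate (hkp.mono (by omega))
      exact ((hkp.mono hj'.le).mul (hFi.mono hj'.le)).mul hkj j le_rfl (by grind)
    rw [J.add_mem_iff_left h2, J.add_mem_iff_left h1] at h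
    exact h

variable {I : A →ₗ[ℝ] ℝ}

/-- The first variation of the energy. -/
theorem energy_variation (hc : ∀ f, P (D f) = D (P f) + k * F * D f)
    (hPk : P k = D (D F) + k ^ 2 * F) (hPJ : ∀ f ∈ J, P f ∈ J) (hF : D F ∈ J)
    (hk : ∀ i ≤ m, D^[2 * i + 1] k ∈ J) (hI : ∀ f ∈ J, I (D f) = 0) :
    I (P (D^[m] k ^ 2) - k * F * D^[m] k ^ 2) =
      2 * I (F * ((-1 : ℝ) ^ m • D^[2 * m + 2] k
        + ∑ j ∈ Finset.Icc 1 m, (-1 : ℝ) ^ j • (k * D^[m + j] k * D^[m - j] k)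
        + (1 / 2 : ℝ) • (k * D^[m] k ^ 2))) := by
  have hkp := hasParity_curvature hk
  -- Order `m + 1` is just enough for the `m + 2` integrations by parts in `e1`.
  have hFp : HasParity D J (m + 1) 0 F :=
    (hasParity_speed hc hPk hPJ hF hk (m + 1) le_rfl).mono (by omega)
  have hkm : HasParity D J (m + 1) m (D^[m] k) :=
    (HasParity.iterate (N := m + 1) (j := m) (hkp.mono (by omega))).congr (by grind)
  have e1 : I (D^[m] (D (D F)) * D^[m] k) = (-1) ^ m * I (F * D^[2 * m + 2] k) := by
    have := hFp.integral_iterate_mul hI (j := m + 2) hkm (by omega) (by grind)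
    rw [Function.iterate_add_apply, ← Function.iterate_add_apply D (m + 2) m] at this
    rw [show 2 * m + 2 = m + 2 + m by ring]
    simpa [pow_add] using this
  have e2 : I (D^[m] (k ^ 2 * F) * D^[m] k) = (-1) ^ m * I (k ^ 2 * F * D^[m + m] k) := by
    have h0 : HasParity D J m (0 + 0 + 0) (k * k * F) :=
      ((hkp.mono (by omega)).mul (hkp.mono (by omega))).mul (hFp.mono (by omega))
    have := h0.integral_iterate_mul hI (j := m) (hkm.mono (by omega)) (by omega) (by grind)
    rwa [← pow_two, ← Function.iterate_add_apply] at this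
  have e3 : ∀ j ∈ Finset.range m, I (D^[j] (k * F * D^[m - j] k) * D^[m] k) =
      (-1) ^ j * I (k * F * D^[m - j] k * D^[m + j] k) := by
    intro j hj
    have hj' := Finset.mem_range.1 hj
    have hkj : HasParity D J m (0 + (m - j)) (D^[m - j] k) :=
      HasParity.iterate (hkp.mono (by omega))
    have h0 : HasParity D J m (0 + 0 + (0 + (m - j))) (k * F * D^[m - j] k) :=
      ((hkp.mono (by omega)).mul (hFp.mono (by omega))).mul hkj
    have := h0.integral_iterate_mul hI (j := j) (hkm.mono (by omega)) (by omega) (by grind)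
    rwa [← Function.iterate_add_apply, add_comm j m] at this
  -- The term `k ^ 2 * F` of `P k` supplies the missing index `j = m` of the commutator sum.
  have e4 : I (P (D^[m] k) * D^[m] k) = (-1) ^ m * I (F * D^[2 * m + 2] k) +
      ∑ j ∈ Finset.range (m + 1), (-1) ^ j * I (k * F * D^[m - j] k * D^[m + j] k) := by
    rw [evolution_iterate hc, hPk, iterate_map_add, add_mul, add_mul, map_add, map_add, e1, e2,
      Finset.sum_mul, map_sum, Finset.sum_congr rfl e3, Finset.sum_range_succ]
    have : k * F * D^[m - m] k = k ^ 2 * F := by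
      rw [Nat.sub_self, Function.iterate_zero_apply]; ring
    rw [this]
    ring
  -- The term `j = 0` occurs twice in the derivative of the square; the variation of ds removes one
  -- copy, whence the coefficient 1/2 in the gradient.
  have e5 : ∑ j ∈ Finset.range (m + 1), (-1 : ℝ) ^ j * I (k * F * D^[m - j] k * D^[m + j] k) =
      I (k * F * D^[m] k ^ 2) +
      ∑ j ∈ Finset.Icc 1 m, (-1 : ℝ) ^ j * I (F * (k * D^[m + j] k * D^[m - j] k)) := by
    rw [Finset.range_eq_Ico, Finset.sum_eq_sum_Ico_succ_bot (by omega)]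
    congr 1
    · simp [pow_two, mul_assoc]
    · refine Finset.sum_congr (by ext; simp) fun j _ => ?_
      congr 2
      ring
  have e6 : P (D^[m] k ^ 2) = (2 : ℝ) • (P (D^[m] k) * D^[m] k) := by
    rw [pow_two, P.leibniz, smul_eq_mul, two_smul, mul_comm]
  rw [e6, map_sub, map_smul, e4, e5]
  simp only [mul_add, Finset.mul_sum, mul_smul_comm, map_add, map_smul, map_sum, smul_eq_mul]
  rw [show F * (k * D^[m] k ^ 2) = k * F * D^[m] k ^ 2 by ring]
  ring

end Evolution

end PlaneCurve

end

/-! ### Integration along a time slice and the Poincaré inequality. -/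

noncomputable section
namespace PlaneCurve

variable {T : ℝ} {v w : smoothFun T} {t : ℝ}

/-- The smooth functions on the slab vanishing at both ends of the curves. -/
def endIdeal (T : ℝ) : Ideal (smoothFun T) where
  carrier := {f | ∀ t ∈ Set.Ioo 0 T, ∀ x ∈ ({-1, 1} : Set ℝ), ext f (t, x) = 0}
  add_mem' hf hg t ht x hx := by simp [hf t ht x hx, hg t ht x hx]
  zero_mem' t ht x hx := by simp
  smul_mem' c f hf t ht x hx := by simp [hf t ht x hx]

theorem ends_subset : ({-1, 1} : Set ℝ) ⊆ paramInterval := by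
  intro x hx
  rcases hx with rfl | rfl <;> simp [paramInterval]

/-- The ends sit at fixed parameter values, so boundary identities can be differentiated in time. -/
theorem timeDeriv_mem_endIdeal {f : smoothFun T} (hf : f ∈ endIdeal T) :
    timeDeriv f ∈ endIdeal T := by
  intro t ht x hx
  refine (hasDerivAt_time f ht (ends_subset hx)).unique ?_
  refine (hasDerivAt_const t (0 : ℝ)).congr_of_eventuallyEq ?_
  filter_upwards [Ioo_mem_nhds ht.1 ht.2] with τ hτ using hf τ hτ x hx

theorem continuousOn_slice (f : smoothFun T) (ht : t ∈ Set.Ioo 0 T) :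
    ContinuousOn (fun x => ext f (t, x)) paramInterval :=
  fun _ hx => (hasDerivWithinAt_space f ht hx).continuousWithinAt

theorem uIcc_subset_paramInterval {x y : ℝ} (hx : x ∈ paramInterval) (hy : y ∈ paramInterval) :
    Set.uIcc x y ⊆ paramInterval :=
  Set.OrdConnected.uIcc_subset (by unfold paramInterval; infer_instance) hx hy

theorem uIcc_eq_paramInterval : Set.uIcc (-1 : ℝ) 1 = paramInterval :=
  Set.uIcc_of_le (by norm_num)

theorem intervalIntegrable_of_continuousOn_paramInterval {g : ℝ → ℝ}
    (hg : ContinuousOn g paramInterval) :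
    IntervalIntegrable g MeasureTheory.volume (-1) 1 :=
  ContinuousOn.intervalIntegrable (by rwa [uIcc_eq_paramInterval])

theorem integral_spaceDeriv (f : smoothFun T) (ht : t ∈ Set.Ioo 0 T) {x y : ℝ}
    (hx : x ∈ paramInterval) (hy : y ∈ paramInterval) :
    ∫ z in x..y, ext (spaceDeriv f) (t, z) = ext f (t, y) - ext f (t, x) := by
  have hsub := uIcc_subset_paramInterval hx hy
  refine intervalIntegral.integral_eq_sub_of_hasDeriv_right
    ((continuousOn_slice f ht).mono hsub) (fun z hz => ?_)
    (((continuousOn_slice (spaceDeriv f) ht).mono hsub).intervalIntegrable)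
  have hz' : z ∈ interior paramInterval := by
    rw [paramInterval, interior_Icc]
    exact ⟨(le_min hx.1 hy.1).trans_lt hz.1, hz.2.trans_le (max_le hx.2 hy.2)⟩
  exact ((hasDerivWithinAt_space f ht (interior_subset hz')).hasDerivAt
    (mem_interior_iff_mem_nhds.1 hz')).hasDerivWithinAt

/-- Integration of smooth functions against arclength along the curve at time `t`. -/
def sliceIntegral (v : smoothFun T) (t : ℝ) (ht : t ∈ Set.Ioo 0 T) : smoothFun T →ₗ[ℝ] ℝ where
  toFun f := ∫ x in (-1 : ℝ)..1, ext f (t, x) * ext v (t, x)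
  map_add' f g := by
    simp only [ext_add, add_mul]
    exact intervalIntegral.integral_add
      (intervalIntegrable_of_continuousOn_paramInterval
        ((continuousOn_slice f ht).mul (continuousOn_slice v ht)))
      (intervalIntegrable_of_continuousOn_paramInterval
        ((continuousOn_slice g ht).mul (continuousOn_slice v ht)))
  map_smul' r f := by
    simp only [ext_smul, mul_assoc, RingHom.id_apply, smul_eq_mul]
    exact intervalIntegral.integral_const_mul _ _

/-- Differentiation by arclength, where `w` is the inverse of the parameter speed. -/
abbrev arcDerivation (w : smoothFun T) : Derivation ℝ (smoothFun T) (smoothFun T) :=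
  w • spaceDeriv

theorem ext_arcDerivation (f : smoothFun T) (p : ℝ × ℝ) :
    ext (arcDerivation w f) p = ext w p * ext (spaceDeriv f) p := by
  rw [Derivation.smul_apply, smul_eq_mul, ext_mul]

theorem ext_arcDerivation_mul (hvw : w * v = 1) (f : smoothFun T) {p : ℝ × ℝ}
    (hp : p ∈ slab T) : ext (arcDerivation w f) p * ext v p = ext (spaceDeriv f) p := by
  have : ext w p * ext v p = 1 := by rw [← ext_mul, hvw, ext_one hp]
  rw [ext_arcDerivation]
  linear_combination ext (spaceDeriv f) p * this

/-- Since f_s ds = f_x dx, this is the fundamental theorem of calculus. It supplies the hypothesis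
on `I` in the parity calculus. -/
theorem sliceIntegral_arcDerivation (hvw : w * v = 1) (ht : t ∈ Set.Ioo 0 T) {f : smoothFun T}
    (hf : f ∈ endIdeal T) : sliceIntegral v t ht (arcDerivation w f) = 0 := by
  have h := integral_spaceDeriv f ht (x := -1) (y := 1) (by simp [paramInterval])
    (by simp [paramInterval])
  rw [hf t ht 1 (by simp), hf t ht (-1) (by simp), sub_zero] at h
  rw [← h]
  refine intervalIntegral.integral_congr fun x hx => ?_
  rw [uIcc_eq_paramInterval] at hx
  exact ext_arcDerivation_mul hvw f ⟨ht, hx⟩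

theorem continuousOn_ext (f : smoothFun T) : ContinuousOn (ext f) (slab T) :=
  (contDiffOn_ext f).continuousOn

/-- Differentiation under the integral sign. -/
theorem hasDerivAt_integral (f : smoothFun T) (ht : t ∈ Set.Ioo 0 T) :
    HasDerivAt (fun τ => ∫ x in (-1 : ℝ)..1, ext f (τ, x))
      (∫ x in (-1 : ℝ)..1, ext (timeDeriv f) (t, x)) t := by
  obtain ⟨δ, hδ, hsub⟩ := Metric.nhds_basis_closedBall.mem_iff.1 (Ioo_mem_nhds ht.1 ht.2)
  have hcomp : IsCompact (Metric.closedBall t δ ×ˢ paramInterval) :=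
    (isCompact_closedBall t δ).prod isCompact_Icc
  obtain ⟨M, hM⟩ := hcomp.exists_bound_of_continuousOn
    ((continuousOn_ext (timeDeriv f)).mono (Set.prod_mono hsub le_rfl))
  have hmem : ∀ x ∈ Set.uIoc (-1 : ℝ) 1, x ∈ paramInterval := fun x hx => by
    rw [← uIcc_eq_paramInterval]; exact Set.uIoc_subset_uIcc hx
  refine (intervalIntegral.hasDerivAt_integral_of_dominated_loc_of_deriv_le
    (bound := fun _ => M) (F' := fun τ x => ext (timeDeriv f) (τ, x))
    (Metric.ball_mem_nhds t hδ) ?_ ?_ ?_ ?_ ?_ ?_).2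
  · filter_upwards [Ioo_mem_nhds ht.1 ht.2] with τ hτ
    exact (intervalIntegrable_of_continuousOn_paramInterval
      (continuousOn_slice f hτ)).def'.aestronglyMeasurable
  · exact intervalIntegrable_of_continuousOn_paramInterval (continuousOn_slice f ht)
  · exact (intervalIntegrable_of_continuousOn_paramInterval
      (continuousOn_slice _ ht)).def'.aestronglyMeasurable
  · exact Filter.Eventually.of_forall fun x hx τ hτ =>
      hM (τ, x) ⟨Metric.ball_subset_closedBall hτ, hmem x hx⟩
  · exact intervalIntegrable_const
  · exact Filter.Eventually.of_forall fun x hx τ hτ =>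
      hasDerivAt_time f (hsub (Metric.ball_subset_closedBall hτ)) (hmem x hx)

/-- The length element `v dx` shrinks at rate `h`; for the flow `h = k * F`. -/
theorem hasDerivAt_integral_mul (f : smoothFun T) {h : smoothFun T} (hv : timeDeriv v = -(h * v))
    (ht : t ∈ Set.Ioo 0 T) :
    HasDerivAt (fun τ => ∫ x in (-1 : ℝ)..1, ext f (τ, x) * ext v (τ, x))
      (sliceIntegral v t ht (timeDeriv f - h * f)) t := by
  have h1 := hasDerivAt_integral (f * v) ht
  have h2 : timeDeriv (f * v) = (timeDeriv f - h * f) * v := by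
    rw [timeDeriv.leibniz, smul_eq_mul, smul_eq_mul, hv]; ring
  simp only [h2, ext_mul] at h1
  exact h1

theorem sliceIntegral_mono (hv : ∀ p ∈ slab T, 0 < ext v p) (ht : t ∈ Set.Ioo 0 T)
    {f g : smoothFun T} (h : ∀ x ∈ paramInterval, ext f (t, x) ≤ ext g (t, x)) :
    sliceIntegral v t ht f ≤ sliceIntegral v t ht g := by
  refine intervalIntegral.integral_mono_on (by norm_num)
    (intervalIntegrable_of_continuousOn_paramInterval
      ((continuousOn_slice f ht).mul (continuousOn_slice v ht)))
    (intervalIntegrable_of_continuousOn_paramInterval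
      ((continuousOn_slice g ht).mul (continuousOn_slice v ht))) fun x hx => ?_
  exact mul_le_mul_of_nonneg_right (h x hx) (hv (t, x) ⟨ht, hx⟩).le

theorem sliceIntegral_sq_nonneg (hv : ∀ p ∈ slab T, 0 < ext v p) (ht : t ∈ Set.Ioo 0 T)
    (f : smoothFun T) : 0 ≤ sliceIntegral v t ht (f ^ 2) := by
  rw [← map_zero (sliceIntegral v t ht)]
  refine sliceIntegral_mono hv ht fun x hx => ?_
  rw [ext_zero, ext_pow _ ⟨ht, hx⟩]
  positivity

theorem sliceIntegral_one_pos (hv : ∀ p ∈ slab T, 0 < ext v p) (ht : t ∈ Set.Ioo 0 T) :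
    0 < sliceIntegral v t ht 1 := by
  refine intervalIntegral.intervalIntegral_pos_of_pos_on
    (intervalIntegrable_of_continuousOn_paramInterval
      ((continuousOn_slice 1 ht).mul (continuousOn_slice v ht))) (fun x hx => ?_) (by norm_num)
  have hp : (t, x) ∈ slab T := ⟨ht, Set.Ioo_subset_Icc_self hx⟩
  rw [ext_one hp, one_mul]
  exact hv _ hp

/-- Rolle's theorem on the parameter interval. -/
theorem exists_arcDerivation_eq_zero (ht : t ∈ Set.Ioo 0 T) {f : smoothFun T}
    (hf : f ∈ endIdeal T) : ∃ x ∈ paramInterval, ext (arcDerivation w f) (t, x) = 0 := by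
  obtain ⟨x, hx, h⟩ := exists_hasDerivAt_eq_zero (f := fun x => ext f (t, x))
    (f' := fun x => ext (spaceDeriv f) (t, x)) (a := -1) (b := 1) (by norm_num)
    (continuousOn_slice f ht)
    (by rw [hf t ht 1 (by simp), hf t ht (-1) (by simp)])
    fun x hx => (hasDerivWithinAt_space f ht (Set.Ioo_subset_Icc_self hx)).hasDerivAt
      (Icc_mem_nhds hx.1 hx.2)
  exact ⟨x, Set.Ioo_subset_Icc_self hx, by rw [ext_arcDerivation, h, mul_zero]⟩

/-- Without a zero, `f` would have a constant sign by the intermediate value theorem, and its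
integral would not vanish. -/
theorem exists_eq_zero_of_sliceIntegral_eq_zero (hv : ∀ p ∈ slab T, 0 < ext v p)
    (ht : t ∈ Set.Ioo 0 T) {f : smoothFun T} (hf : sliceIntegral v t ht f = 0) :
    ∃ x ∈ paramInterval, ext f (t, x) = 0 := by
  have hc : ContinuousOn (fun x => ext f (t, x) * ext v (t, x)) paramInterval :=
    (continuousOn_slice f ht).mul (continuousOn_slice v ht)
  have hint := intervalIntegrable_of_continuousOn_paramInterval hc
  have hpre : IsPreconnected paramInterval := isPreconnected_Icc
  by_contra! hne
  have hsign : (∀ x ∈ paramInterval, 0 < ext f (t, x)) ∨ ∀ x ∈ paramInterval, ext f (t, x) < 0 := by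
    by_contra! h
    obtain ⟨⟨x, hx, hfx⟩, y, hy, hfy⟩ := h
    obtain ⟨z, hz, hfz⟩ := hpre.intermediate_value hx hy (continuousOn_slice f ht) ⟨hfx, hfy⟩
    exact hne z hz hfz
  rcases hsign with h | h
  · refine (intervalIntegral.intervalIntegral_pos_of_pos_on hint (fun x hx => ?_)
      (by norm_num)).ne' hf
    exact mul_pos (h x (Set.Ioo_subset_Icc_self hx)) (hv _ ⟨ht, Set.Ioo_subset_Icc_self hx⟩)
  · have := intervalIntegral.intervalIntegral_pos_of_pos_on hint.neg (fun x hx => ?_)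
      (by norm_num)
    · rw [Pi.neg_def, intervalIntegral.integral_neg] at this
      have hf' : ∫ x in (-1 : ℝ)..1, ext f (t, x) * ext v (t, x) = 0 := hf
      linarith
    · exact neg_pos.2 (mul_neg_of_neg_of_pos (h x (Set.Ioo_subset_Icc_self hx))
        (hv _ ⟨ht, Set.Ioo_subset_Icc_self hx⟩))

/-- A function vanishing somewhere on the curve satisfies `sup f² ≤ L ∫ f_s² ds`. -/
theorem sq_le_of_exists_zero (hvw : w * v = 1) (hv : ∀ p ∈ slab T, 0 < ext v p)
    (ht : t ∈ Set.Ioo 0 T) {f : smoothFun T} (hf : ∃ x ∈ paramInterval, ext f (t, x) = 0)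
    {y : ℝ} (hy : y ∈ paramInterval) :
    ext f (t, y) ^ 2 ≤ sliceIntegral v t ht 1 * sliceIntegral v t ht (arcDerivation w f ^ 2) := by
  obtain ⟨x, hx, hfx⟩ := hf
  set L := sliceIntegral v t ht 1
  have hL : 0 < L := sliceIntegral_one_pos hv ht
  set g := spaceDeriv f
  have hgc : ContinuousOn (fun z => |ext g (t, z)|) paramInterval := (continuousOn_slice g ht).abs
  set N := ∫ z in (-1 : ℝ)..1, |ext g (t, z)|
  have h1 : |ext f (t, y)| ≤ N := by
    have h := integral_spaceDeriv f ht hx hy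
    rw [hfx, sub_zero] at h
    rw [← h, ← Real.norm_eq_abs]
    refine intervalIntegral.norm_integral_le_abs_integral_norm.trans ?_
    rw [intervalIntegral.abs_integral_eq_abs_integral_uIoc]
    rw [abs_of_nonneg (MeasureTheory.integral_nonneg fun _ => norm_nonneg _)]
    simp only [N]
    rw [intervalIntegral.integral_of_le (by norm_num), ← Set.uIoc_of_le (by norm_num : (-1:ℝ) ≤ 1)]
    refine MeasureTheory.setIntegral_mono_set
      (intervalIntegrable_of_continuousOn_paramInterval hgc).def'
      (Filter.Eventually.of_forall fun _ => abs_nonneg _) (Filter.Eventually.of_forall ?_)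
    rw [Set.uIoc_of_le (by norm_num : (-1:ℝ) ≤ 1)]
    exact Set.Ioc_subset_Ioc (le_min hx.1 hy.1) (max_le hx.2 hy.2)
  -- Cauchy–Schwarz in the form ∫ (|f_s| - N/L)² ds ≥ 0, where N/L is the mean of |f_s|; it gives N²
  -- ≤ L ∫ f_s² ds.
  have h2 : 0 ≤ ∫ z in (-1 : ℝ)..1,
      (ext (arcDerivation w f ^ 2) (t, z) * ext v (t, z) - 2 * (N / L) * |ext g (t, z)|
        + (N / L) ^ 2 * (ext (1 : smoothFun T) (t, z) * ext v (t, z))) := by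
    refine intervalIntegral.integral_nonneg (by norm_num) fun z hz => ?_
    have hp : (t, z) ∈ slab T := ⟨ht, hz⟩
    rw [ext_one hp, ext_pow _ hp, ← ext_arcDerivation_mul hvw f hp, abs_mul, abs_of_pos (hv _ hp),
      ← sq_abs]
    have := mul_nonneg (sq_nonneg (|ext (arcDerivation w f) (t, z)| - N / L)) (hv _ hp).le
    nlinarith
  have c1 := (continuousOn_slice (arcDerivation w f ^ 2) ht).mul (continuousOn_slice v ht)
  have c2 := (continuousOn_slice 1 ht).mul (continuousOn_slice v ht)
  rw [intervalIntegral.integral_add, intervalIntegral.integral_sub,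
    intervalIntegral.integral_const_mul, intervalIntegral.integral_const_mul] at h2
  rotate_left
  · exact intervalIntegrable_of_continuousOn_paramInterval c1
  · exact (intervalIntegrable_of_continuousOn_paramInterval hgc).const_mul _
  · exact (intervalIntegrable_of_continuousOn_paramInterval c1).sub
      ((intervalIntegrable_of_continuousOn_paramInterval hgc).const_mul _)
  · exact (intervalIntegrable_of_continuousOn_paramInterval c2).const_mul _
  have h3 : 0 ≤ sliceIntegral v t ht (arcDerivation w f ^ 2) - 2 * (N / L) * N + (N / L) ^ 2 * L :=
    h2
  have h4 : (N / L) ^ 2 * L = N ^ 2 / L := by field_simp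
  have h5 : 2 * (N / L) * N = 2 * (N ^ 2 / L) := by field_simp
  have h6 : N ^ 2 / L ≤ sliceIntegral v t ht (arcDerivation w f ^ 2) := by linarith
  rw [div_le_iff₀ hL] at h6
  calc ext f (t, y) ^ 2 = |ext f (t, y)| ^ 2 := (sq_abs _).symm
    _ ≤ N ^ 2 := pow_le_pow_left₀ (abs_nonneg _) h1 2
    _ ≤ _ := by linarith

end PlaneCurve

end

noncomputable section
namespace PlaneCurve

/-! ### First variation of length. -/

section LengthVariation

variable {A : Type*} [CommRing A] [Algebra ℝ A] {D : Derivation ℝ A A} {J : Ideal A}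
  {k F : A} {m : ℕ} {I : A →ₗ[ℝ] ℝ}

/-- The first variation of length under the flow. -/
theorem length_variation (hk : ∀ i ≤ m, D^[2 * i + 1] k ∈ J) (hI : ∀ f ∈ J, I (D f) = 0)
    (hF : F = -((-1 : ℝ) ^ m • D^[2 * m + 2] k
        + ∑ j ∈ Finset.Icc 1 m, (-1 : ℝ) ^ j • (k * D^[m + j] k * D^[m - j] k)
        + (1 / 2 : ℝ) • (k * D^[m] k ^ 2))) :
    I (k * F) = I (D^[m + 1] k ^ 2)
      - ∑ j ∈ Finset.Icc 1 m, I (D^[j] (k * k * D^[m - j] k) * D^[m] k)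
      - 1 / 2 * I (k * k * D^[m] k * D^[m] k) := by
  have hkp := hasParity_curvature hk
  have e1 : I (k * D^[2 * m + 2] k) = (-1) ^ (m + 1) * I (D^[m + 1] k ^ 2) := by
    have h0 : HasParity D J m (0 + (m + 1)) (D^[m + 1] k) :=
      HasParity.iterate (hkp.mono (by omega))
    have := h0.integral_iterate_mul hI (j := m + 1) (hkp.mono (by omega)) (by omega) (by grind)
    rw [← Function.iterate_add_apply, mul_comm, ← pow_two] at this
    rw [← this]
    congr 3
    ring
  -- Moving `j` derivatives off k_{s^{m+j}} leaves no derivative of order above `m`, the range in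
  -- which zeros are available.
  have e2 : ∀ j ∈ Finset.Icc 1 m, (-1) ^ j * I (k * (k * D^[m + j] k * D^[m - j] k)) =
      I (D^[j] (k * k * D^[m - j] k) * D^[m] k) := by
    intro j hj
    have hj' := Finset.mem_Icc.1 hj
    have h0 : HasParity D J m (0 + (m - j)) (D^[m - j] k) :=
      HasParity.iterate (hkp.mono (by omega))
    have h1 : HasParity D J m (0 + m) (D^[m] k) :=
      HasParity.iterate (hkp.mono (by omega))
    have h2 : HasParity D J m (0 + 0 + (0 + (m - j))) (k * k * D^[m - j] k) :=
      ((hkp.mono (by omega)).mul (hkp.mono (by omega))).mul h0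
    rw [h2.integral_iterate_mul hI (j := j) h1 (by omega) (by grind),
      ← Function.iterate_add_apply, add_comm j m]
    congr 2
    ring
  have e3 : k * (k * D^[m] k ^ 2) = k * k * D^[m] k * D^[m] k := by ring
  rw [hF, ← Finset.sum_congr rfl e2, ← e3]
  simp only [mul_neg, mul_add, Finset.mul_sum, mul_smul_comm, map_neg, map_add, map_smul, map_sum,
    smul_eq_mul, e1]
  have : ((-1 : ℝ) ^ m) * (-1) ^ m = 1 := by rw [← mul_pow]; simp
  rw [pow_succ]
  linear_combination I (D^[m + 1] k ^ 2) * this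
end LengthVariation

/-! ### Interpolation and absorption of the quartic terms. -/

section Estimates

variable {T : ℝ} {v w k : smoothFun T} {t : ℝ} {m : ℕ}

/-- Odd derivatives vanish at the ends, positive even ones have a zero by Rolle applied to the
preceding odd one, and `k` itself has one because its integral is zero. -/
theorem exists_iterate_eq_zero (hv : ∀ p ∈ slab T, 0 < ext v p) (ht : t ∈ Set.Ioo 0 T)
    (hk : ∀ i ≤ m, (arcDerivation w)^[2 * i + 1] k ∈ endIdeal T)
    (hw0 : sliceIntegral v t ht k = 0) (i : ℕ) (hi : i ≤ m) :
    ∃ x ∈ paramInterval, ext ((arcDerivation w)^[i] k) (t, x) = 0 := by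
  rcases Nat.even_or_odd' i with ⟨j, rfl | rfl⟩
  · rcases j with _ | j
    · exact exists_eq_zero_of_sliceIntegral_eq_zero hv ht hw0
    · have := exists_arcDerivation_eq_zero (w := w) ht (hk j (by omega))
      rwa [← Function.iterate_succ_apply' (arcDerivation w)] at this
  · exact ⟨1, by simp [paramInterval], hk j (by omega) t ht 1 (by simp)⟩

/-- Interpolation bounds for the derivatives of a function all of whose lower derivatives vanish
somewhere on the curve. -/
theorem iterate_bounds (hvw : w * v = 1) (hv : ∀ p ∈ slab T, 0 < ext v p) (ht : t ∈ Set.Ioo 0 T)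
    (hz : ∀ i ≤ m, ∃ x ∈ paramInterval, ext ((arcDerivation w)^[i] k) (t, x) = 0)
    {n i : ℕ} (hi : i + n ≤ m + 1) :
    sliceIntegral v t ht ((arcDerivation w)^[i] k ^ 2) ≤
      sliceIntegral v t ht 1 ^ (2 * n) *
        sliceIntegral v t ht ((arcDerivation w)^[i + n] k ^ 2) := by
  induction n generalizing i with
  | zero => simp
  | succ n ih =>
    set L := sliceIntegral v t ht 1
    have hL : 0 < L := sliceIntegral_one_pos hv ht
    -- Integrating the supremum bound over the curve costs a second factor L.
    have h1 : sliceIntegral v t ht ((arcDerivation w)^[i] k ^ 2) ≤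
        L ^ 2 * sliceIntegral v t ht ((arcDerivation w)^[i + 1] k ^ 2) := by
      have := sliceIntegral_mono hv ht (f := (arcDerivation w)^[i] k ^ 2)
        (g := (L * sliceIntegral v t ht ((arcDerivation w)^[i + 1] k ^ 2)) • 1) fun x hx => by
          rw [ext_pow _ ⟨ht, hx⟩, ext_smul, ext_one ⟨ht, hx⟩, mul_one,
            Function.iterate_succ_apply']
          exact sq_le_of_exists_zero hvw hv ht (hz i (by omega)) hx
      rw [map_smul, smul_eq_mul] at this
      linarith
    have h2 := ih (i := i + 1) (by omega)
    calc _ ≤ _ := h1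
      _ ≤ L ^ 2 * (L ^ (2 * n) * sliceIntegral v t ht ((arcDerivation w)^[i + 1 + n] k ^ 2)) := by
        gcongr
      _ = _ := by rw [add_right_comm, add_assoc]; ring

/-- One supremum bound, costing L, followed by `n` Poincaré steps, each costing L². -/
theorem iterate_sup_bound (hvw : w * v = 1) (hv : ∀ p ∈ slab T, 0 < ext v p)
    (ht : t ∈ Set.Ioo 0 T)
    (hz : ∀ i ≤ m, ∃ x ∈ paramInterval, ext ((arcDerivation w)^[i] k) (t, x) = 0)
    {n i : ℕ} (hi : i + n = m) {x : ℝ} (hx : x ∈ paramInterval) :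
    ext ((arcDerivation w)^[i] k) (t, x) ^ 2 ≤ sliceIntegral v t ht 1 ^ (2 * n + 1) *
        sliceIntegral v t ht ((arcDerivation w)^[m + 1] k ^ 2) := by
  have h1 := sq_le_of_exists_zero hvw hv ht (hz i (by omega)) hx
  rw [← Function.iterate_succ_apply' (arcDerivation w)] at h1
  have h2 := iterate_bounds hvw hv ht hz (n := n) (i := i + 1) (by omega)
  have hL : 0 < sliceIntegral v t ht 1 := sliceIntegral_one_pos hv ht
  calc _ ≤ _ := h1
    _ ≤ _ := mul_le_mul_of_nonneg_left h2 hL.le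
    _ = _ := by rw [show i + 1 + n = m + 1 by omega]; ring

/-- The factors of orders `a` and `b` are taken in supremum, together costing one ∫ k_{s^{m+1}}² ds.
The other two are paired by a weighted Young inequality, which gives the energy. -/
theorem quartic_bound (hvw : w * v = 1) (hv : ∀ p ∈ slab T, 0 < ext v p)
    (ht : t ∈ Set.Ioo 0 T)
    (hz : ∀ i ≤ m, ∃ x ∈ paramInterval, ext ((arcDerivation w)^[i] k) (t, x) = 0)
    {a b c : ℕ} (h : a + b + c = m) :
    |sliceIntegral v t ht ((arcDerivation w)^[a] k * (arcDerivation w)^[b] k *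
      (arcDerivation w)^[c] k * (arcDerivation w)^[m] k)| ≤
      sliceIntegral v t ht 1 ^ (2 * m + 1) * sliceIntegral v t ht ((arcDerivation w)^[m] k ^ 2) *
        sliceIntegral v t ht ((arcDerivation w)^[m + 1] k ^ 2) := by
  set L := sliceIntegral v t ht 1
  have hL : 0 < L := sliceIntegral_one_pos hv ht
  set E := sliceIntegral v t ht ((arcDerivation w)^[m] k ^ 2)
  set B := sliceIntegral v t ht ((arcDerivation w)^[m + 1] k ^ 2)
  have hB : 0 ≤ B := sliceIntegral_sq_nonneg hv ht _
  have hE : 0 ≤ E := sliceIntegral_sq_nonneg hv ht _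
  have hab : ∀ x ∈ paramInterval, |ext ((arcDerivation w)^[a] k) (t, x) *
      ext ((arcDerivation w)^[b] k) (t, x)| ≤ L ^ (m + c + 1) * B := by
    intro x hx
    refine abs_le_of_sq_le_sq ?_ (by positivity)
    have h1 := iterate_sup_bound hvw hv ht hz (n := b + c) (i := a) (by omega) hx
    have h2 := iterate_sup_bound hvw hv ht hz (n := a + c) (i := b) (by omega) hx
    calc _ = ext ((arcDerivation w)^[a] k) (t, x) ^ 2 *
          ext ((arcDerivation w)^[b] k) (t, x) ^ 2 := by ring
      _ ≤ (L ^ (2 * (b + c) + 1) * B) * (L ^ (2 * (a + c) + 1) * B) :=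
        mul_le_mul h1 h2 (sq_nonneg _) (by positivity)
      _ = _ := by rw [← h]; ring
  set n := m - c
  -- The weight `L ^ n`, `n = m - c`, balances the two terms: the Poincaré steps bound ∫ k_{s^c}² ds
  -- by L^{2n} E, so each contributes at most L^n E.
  set g : smoothFun T := (1 / 2 * (L ^ (m + c + 1) * B)) • ((L ^ n)⁻¹ • (arcDerivation w)^[c] k ^ 2
    + L ^ n • (arcDerivation w)^[m] k ^ 2)
  have hpt : ∀ x ∈ paramInterval, |ext ((arcDerivation w)^[a] k * (arcDerivation w)^[b] k *
      (arcDerivation w)^[c] k * (arcDerivation w)^[m] k) (t, x)| ≤ ext g (t, x) := by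
    intro x hx
    have hp : (t, x) ∈ slab T := ⟨ht, hx⟩
    simp only [g, ext_mul, ext_smul, ext_add, ext_pow _ hp]
    set p := ext ((arcDerivation w)^[c] k) (t, x)
    set q := ext ((arcDerivation w)^[m] k) (t, x)
    have hpq : |p * q| ≤ 1 / 2 * ((L ^ n)⁻¹ * p ^ 2 + L ^ n * q ^ 2) := by
      have hLn : 0 < L ^ n := by positivity
      have h3 : 0 ≤ (L ^ n)⁻¹ * (|p| - L ^ n * |q|) ^ 2 := by positivity
      have h4 : (L ^ n)⁻¹ * (|p| - L ^ n * |q|) ^ 2 =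
          (L ^ n)⁻¹ * |p| ^ 2 + L ^ n * |q| ^ 2 - 2 * (|p| * |q|) := by
        field_simp
        ring
      rw [sq_abs, sq_abs] at h4
      rw [abs_mul]
      linarith
    rw [mul_assoc (_ * _), abs_mul]
    calc _ ≤ (L ^ (m + c + 1) * B) * (1 / 2 * ((L ^ n)⁻¹ * p ^ 2 + L ^ n * q ^ 2)) :=
        mul_le_mul (hab x hx) hpq (abs_nonneg _) (by positivity)
      _ = _ := by ring
  have hg : sliceIntegral v t ht g ≤ L ^ (2 * m + 1) * E * B := by
    have h5 := iterate_bounds hvw hv ht hz (n := n) (i := c) (by omega)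
    rw [show c + n = m by omega] at h5
    have h6 : (L ^ n)⁻¹ * sliceIntegral v t ht ((arcDerivation w)^[c] k ^ 2) ≤ L ^ n * E := by
      rw [inv_mul_le_iff₀ (by positivity)]
      calc _ ≤ _ := h5
        _ = _ := by ring
    simp only [g, map_smul, map_add, smul_eq_mul]
    calc _ ≤ 1 / 2 * (L ^ (m + c + 1) * B) * (L ^ n * E + L ^ n * E) := by gcongr
      _ = L ^ (m + c + 1 + n) * E * B := by ring
      _ = _ := by rw [show m + c + 1 + n = 2 * m + 1 by omega]
  refine abs_le.2 ⟨?_, ?_⟩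
  · rw [neg_le, ← map_neg]
    refine (sliceIntegral_mono hv ht fun x hx => ?_).trans hg
    rw [ext_neg]
    exact (neg_le_abs _).trans (hpt x hx)
  · exact (sliceIntegral_mono hv ht fun x hx => (le_abs_self _).trans (hpt x hx)).trans hg

/-- By Leibniz each outer derivative yields three products of the same total order, hence the factor
`3 ^ j`. -/
theorem quartic_bound_iterate (hvw : w * v = 1) (hv : ∀ p ∈ slab T, 0 < ext v p)
    (ht : t ∈ Set.Ioo 0 T)
    (hz : ∀ i ≤ m, ∃ x ∈ paramInterval, ext ((arcDerivation w)^[i] k) (t, x) = 0)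
    {a b c j : ℕ} (h : a + b + c + j = m) :
    |sliceIntegral v t ht ((arcDerivation w)^[j] ((arcDerivation w)^[a] k *
      (arcDerivation w)^[b] k * (arcDerivation w)^[c] k) * (arcDerivation w)^[m] k)| ≤
      3 ^ j * (sliceIntegral v t ht 1 ^ (2 * m + 1) *
        sliceIntegral v t ht ((arcDerivation w)^[m] k ^ 2) *
        sliceIntegral v t ht ((arcDerivation w)^[m + 1] k ^ 2)) := by
  induction j generalizing a b c with
  | zero => simpa using quartic_bound hvw hv ht hz (by omega)
  | succ j ih =>
    set M := sliceIntegral v t ht 1 ^ (2 * m + 1) *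
        sliceIntegral v t ht ((arcDerivation w)^[m] k ^ 2) *
        sliceIntegral v t ht ((arcDerivation w)^[m + 1] k ^ 2)
    have e : arcDerivation w ((arcDerivation w)^[a] k * (arcDerivation w)^[b] k *
        (arcDerivation w)^[c] k) =
        (arcDerivation w)^[a + 1] k * (arcDerivation w)^[b] k * (arcDerivation w)^[c] k
        + (arcDerivation w)^[a] k * (arcDerivation w)^[b + 1] k * (arcDerivation w)^[c] k
        + (arcDerivation w)^[a] k * (arcDerivation w)^[b] k * (arcDerivation w)^[c + 1] k := by
      simp only [Derivation.leibniz, smul_eq_mul, Function.iterate_succ_apply']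
      ring
    rw [Function.iterate_succ_apply, e, iterate_map_add, iterate_map_add, add_mul, add_mul,
      map_add, map_add]
    have h1 := ih (a := a + 1) (b := b) (c := c) (by omega)
    have h2 := ih (a := a) (b := b + 1) (c := c) (by omega)
    have h3 := ih (a := a) (b := b) (c := c + 1) (by omega)
    calc _ ≤ _ := abs_add_three _ _ _
      _ ≤ 3 ^ j * M + 3 ^ j * M + 3 ^ j * M := by gcongr
      _ = _ := by ring

end Estimates

/-- The constant in the length estimate. -/
def lengthConst (m : ℕ) : ℝ := ∑ j ∈ Finset.Icc 1 m, 3 ^ j + 1 / 2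

theorem lengthConst_pos (m : ℕ) : 0 < lengthConst m := by
  unfold lengthConst; positivity

/-- All quartic terms together are at most `lengthConst m` L^{2m+1} E ∫ k_{s^{m+1}}² ds, so
smallness lets the leading term absorb them. -/
theorem length_variation_bound {T : ℝ} {v w k F : smoothFun T} {t : ℝ} {m : ℕ} (hvw : w * v = 1)
    (hv : ∀ p ∈ slab T, 0 < ext v p) (ht : t ∈ Set.Ioo 0 T)
    (hk : ∀ i ≤ m, (arcDerivation w)^[2 * i + 1] k ∈ endIdeal T)
    (hw0 : sliceIntegral v t ht k = 0)
    (hF : F = -((-1 : ℝ) ^ m • (arcDerivation w)^[2 * m + 2] k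
        + ∑ j ∈ Finset.Icc 1 m, (-1 : ℝ) ^ j •
          (k * (arcDerivation w)^[m + j] k * (arcDerivation w)^[m - j] k)
        + (1 / 2 : ℝ) • (k * (arcDerivation w)^[m] k ^ 2)))
    (hsmall : lengthConst m * (sliceIntegral v t ht 1 ^ (2 * m + 1) *
        sliceIntegral v t ht ((arcDerivation w)^[m] k ^ 2)) ≤ 1) :
    0 ≤ sliceIntegral v t ht (k * F) := by
  have hz := exists_iterate_eq_zero hv ht hk hw0
  rw [length_variation hk (fun f hf => sliceIntegral_arcDerivation hvw ht hf) hF]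
  set B := sliceIntegral v t ht ((arcDerivation w)^[m + 1] k ^ 2)
  have hB : 0 ≤ B := sliceIntegral_sq_nonneg hv ht _
  set Φ := sliceIntegral v t ht 1 ^ (2 * m + 1) *
        sliceIntegral v t ht ((arcDerivation w)^[m] k ^ 2)
  have h1 : ∑ j ∈ Finset.Icc 1 m, sliceIntegral v t ht ((arcDerivation w)^[j]
      (k * k * (arcDerivation w)^[m - j] k) * (arcDerivation w)^[m] k) ≤
      ∑ j ∈ Finset.Icc 1 m, 3 ^ j * (Φ * B) := Finset.sum_le_sum fun j hj =>
    (le_abs_self _).trans (quartic_bound_iterate hvw hv ht hz (a := 0) (b := 0) (c := m - j)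
      (by have := Finset.mem_Icc.1 hj; omega))
  have h2 : sliceIntegral v t ht (k * k * (arcDerivation w)^[m] k * (arcDerivation w)^[m] k) ≤
      Φ * B := (le_abs_self _).trans (quartic_bound hvw hv ht hz (a := 0) (b := 0) (c := m)
        (by omega))
  rw [← Finset.sum_mul] at h1
  have h3 := mul_le_mul_of_nonneg_right hsmall hB
  unfold lengthConst at h3
  nlinarith

end PlaneCurve

end

noncomputable section
namespace PlaneCurve

/-! ### Evolution of speed, tangent and curvature. -/

section Frame

variable {A : Type*} [CommRing A] [Algebra ℝ A] {P Q : Derivation ℝ A A} {X Y v w k F : A}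

/-- Evolution of the speed under a normal variation. -/
theorem speed_evolution (hcomm : ∀ f, P (Q f) = Q (P f)) (hwv : w * v = 1)
    (hvP : v * P v = Q X * P (Q X) + Q Y * P (Q Y))
    (hk : k = (w • Q) ((w • Q) Y) * (w • Q) X - (w • Q) ((w • Q) X) * (w • Q) Y)
    (hX : P X = -(F * (w • Q) Y)) (hY : P Y = F * (w • Q) X) :
    P v = -(k * F * v) := by
  have hQ : ∀ f, Q f = v * (w • Q) f := fun f => by
    rw [Derivation.smul_apply, smul_eq_mul, ← mul_assoc, mul_comm v w, hwv, one_mul]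
  rw [hcomm, hcomm, hX, hY, hQ X, hQ Y, hQ (-(F * (w • Q) Y)), hQ (F * (w • Q) X)] at hvP
  generalize w • Q = D at hvP hk
  simp only [map_neg, Derivation.leibniz, smul_eq_mul] at hvP
  linear_combination w * hvP + (w * v * v * F) * hk + (-P v - k * F * v) * hwv

/-- As `w` is the inverse of `v`, it satisfies `P w = k * F * w`, while `P` and `Q` commute. -/
theorem commutator (hcomm : ∀ f, P (Q f) = Q (P f)) (hwv : w * v = 1)
    (hv : P v = -(k * F * v)) (f : A) :
    P ((w • Q) f) = (w • Q) (P f) + k * F * (w • Q) f := by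
  have h := congrArg P hwv
  rw [P.leibniz, P.map_one_eq_zero, smul_eq_mul, smul_eq_mul, hv] at h
  simp only [Derivation.smul_apply, smul_eq_mul, P.leibniz, hcomm]
  linear_combination w * Q f * h + (k * F * w * Q f - P w * Q f) * hwv

variable {D : Derivation ℝ A A}

/-- This is τ_t = F_s ν: the tangential part of (F ν)_s cancels the commutator term. -/
theorem tangent_evolution (hc : ∀ f, P (D f) = D (P f) + k * F * D f)
    (hX : P X = -(F * D Y)) (hY : P Y = F * D X)
    (hXX : D (D X) = -(k * D Y)) (hYY : D (D Y) = k * D X) :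
    P (D X) = -(D F * D Y) ∧ P (D Y) = D F * D X := by
  constructor
  · rw [hc, hX]
    simp only [map_neg, Derivation.leibniz, smul_eq_mul, hYY]
    ring
  · rw [hc, hY]
    simp only [Derivation.leibniz, smul_eq_mul, hXX]
    ring

/-- Differentiate the determinant formula for `k`: the terms with F_s cancel, and |τ| = 1 leaves
F_ss and k² F. -/
theorem curvature_evolution (hc : ∀ f, P (D f) = D (P f) + k * F * D f)
    (hX : P X = -(F * D Y)) (hY : P Y = F * D X) (hu : D X ^ 2 + D Y ^ 2 = 1)
    (hk : k = D (D Y) * D X - D (D X) * D Y)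
    (hXX : D (D X) = -(k * D Y)) (hYY : D (D Y) = k * D X) :
    P k = D (D F) + k ^ 2 * F := by
  obtain ⟨h1, h2⟩ := tangent_evolution hc hX hY hXX hYY
  have e1 : P (D (D X)) = -(D (D F) * D Y) - D F * D (D Y) + k * F * D (D X) := by
    rw [hc (D X), h1]
    simp only [map_neg, Derivation.leibniz, smul_eq_mul]
    ring
  have e2 : P (D (D Y)) = D (D F) * D X + D F * D (D X) + k * F * D (D Y) := by
    rw [hc (D Y), h2]
    simp only [Derivation.leibniz, smul_eq_mul]
    ring
  have e3 : P k = P (D (D Y)) * D X + D (D Y) * P (D X) - P (D (D X)) * D Y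
      - D (D X) * P (D Y) := by
    rw [hk]
    simp only [map_sub, Derivation.leibniz, smul_eq_mul]
    ring
  rw [e3, e1, e2, h1, h2]
  linear_combination D (D F) * hu - k * F * hk

end Frame

/-! ### From complex-valued curves to the algebra. -/

section Bridge

variable {T t : ℝ}

theorem paramDeriv_eq {g : ℝ → ℝ} {f : smoothFun T} (ht : t ∈ Set.Ioo 0 T)
    (h : ∀ x ∈ paramInterval, g x = ext f (t, x)) {x : ℝ} (hx : x ∈ paramInterval) :
    paramDeriv g x = ext (spaceDeriv f) (t, x) :=
  ((hasDerivWithinAt_space f ht hx).congr h (h x hx)).derivWithin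
    (uniqueDiffOn_paramInterval x hx)

theorem paramDeriv_complex_eq {c : ℝ → ℂ} {f g : smoothFun T} (ht : t ∈ Set.Ioo 0 T)
    (h : ∀ x ∈ paramInterval, c x = ⟨ext f (t, x), ext g (t, x)⟩) {x : ℝ}
    (hx : x ∈ paramInterval) :
    paramDeriv c x = ⟨ext (spaceDeriv f) (t, x), ext (spaceDeriv g) (t, x)⟩ := by
  have h' : ∀ x ∈ paramInterval, c x = ext f (t, x) + ext g (t, x) * Complex.I := fun x hx => by
    rw [h x hx, Complex.mk_eq_add_mul_I]
  have h1 := ((hasDerivWithinAt_space f ht hx).ofReal_comp.add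
    ((hasDerivWithinAt_space g ht hx).ofReal_comp.mul_const Complex.I)).congr h' (h' x hx)
  rw [Complex.mk_eq_add_mul_I]
  exact h1.derivWithin (uniqueDiffOn_paramInterval x hx)

variable {c : ℝ → ℂ} {v w : smoothFun T}

theorem arcDeriv_eq {g : ℝ → ℝ} {f : smoothFun T} (ht : t ∈ Set.Ioo 0 T)
    (hw : ∀ x ∈ paramInterval, ‖paramDeriv c x‖⁻¹ = ext w (t, x))
    (h : ∀ x ∈ paramInterval, g x = ext f (t, x)) {x : ℝ} (hx : x ∈ paramInterval) :
    arcDeriv c g x = ext (arcDerivation w f) (t, x) := by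
  rw [arcDeriv, paramDeriv_eq ht h hx, hw x hx, ext_arcDerivation, smul_eq_mul]

theorem arcDeriv_complex_eq {d : ℝ → ℂ} {f g : smoothFun T} (ht : t ∈ Set.Ioo 0 T)
    (hw : ∀ x ∈ paramInterval, ‖paramDeriv c x‖⁻¹ = ext w (t, x))
    (h : ∀ x ∈ paramInterval, d x = ⟨ext f (t, x), ext g (t, x)⟩) {x : ℝ}
    (hx : x ∈ paramInterval) :
    arcDeriv c d x = ⟨ext (arcDerivation w f) (t, x), ext (arcDerivation w g) (t, x)⟩ := by
  rw [arcDeriv, paramDeriv_complex_eq ht h hx, hw x hx, ext_arcDerivation, ext_arcDerivation]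
  apply Complex.ext <;> simp

theorem arcDeriv_iterate_eq {g : ℝ → ℝ} {f : smoothFun T} (ht : t ∈ Set.Ioo 0 T)
    (hw : ∀ x ∈ paramInterval, ‖paramDeriv c x‖⁻¹ = ext w (t, x))
    (h : ∀ x ∈ paramInterval, g x = ext f (t, x)) (j : ℕ) {x : ℝ} (hx : x ∈ paramInterval) :
    (arcDeriv c)^[j] g x = ext ((arcDerivation w)^[j] f) (t, x) := by
  induction j generalizing g f with
  | zero => exact h x hx
  | succ j ih =>
    rw [Function.iterate_succ_apply, Function.iterate_succ_apply]
    exact ih fun y hy => arcDeriv_eq ht hw h hy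

theorem arcIntegral_eq {g : ℝ → ℝ} {f : smoothFun T}
    (hv : ∀ x ∈ paramInterval, ‖paramDeriv c x‖ = ext v (t, x))
    (h : ∀ x ∈ paramInterval, g x = ext f (t, x)) :
    arcIntegral c g = ∫ x in (-1 : ℝ)..1, ext f (t, x) * ext v (t, x) := by
  refine intervalIntegral.integral_congr fun x hx => ?_
  rw [uIcc_eq_paramInterval] at hx
  rw [← h x hx, ← hv x hx]

end Bridge

/-- The geometric quantities of a flow, as smooth functions on the slab: the speed `v` and its
inverse `w`, the curvature `k` and the normal velocity `F`, with their evolution equations and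
boundary conditions. -/
theorem IsGradientFlow.exists_smoothFun {m : ℕ} {e : ℂ} {a b T : ℝ} {γ : ℝ → ℝ → ℂ}
    (h : IsGradientFlow m e a b T γ) :
    ∃ v w k F : smoothFun T, w * v = 1 ∧ (∀ p ∈ slab T, 0 < ext v p) ∧
      (∀ t ∈ Set.Ioo 0 T, ∀ x ∈ paramInterval, ‖paramDeriv (γ t) x‖ = ext v (t, x)) ∧
      (∀ t ∈ Set.Ioo 0 T, ∀ j, ∀ x ∈ paramInterval,
        curvatureDeriv (γ t) j x = ext ((arcDerivation w)^[j] k) (t, x)) ∧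
      F = -((-1 : ℝ) ^ m • (arcDerivation w)^[2 * m + 2] k
        + ∑ j ∈ Finset.Icc 1 m, (-1 : ℝ) ^ j •
          (k * (arcDerivation w)^[m + j] k * (arcDerivation w)^[m - j] k)
        + (1 / 2 : ℝ) • (k * (arcDerivation w)^[m] k ^ 2)) ∧
      timeDeriv v = -(k * F * v) ∧
      (∀ f, timeDeriv (arcDerivation w f) = arcDerivation w (timeDeriv f) +
        k * F * arcDerivation w f) ∧
      timeDeriv k = arcDerivation w (arcDerivation w F) + k ^ 2 * F ∧
      arcDerivation w F ∈ endIdeal T ∧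
      ∀ i ≤ m, (arcDerivation w)^[2 * i + 1] k ∈ endIdeal T := by
  have hreg : ∀ t ∈ Set.Ioo 0 T, ∀ x ∈ paramInterval, paramDeriv (γ t) x ≠ 0 := fun t ht =>
    h.regular t (Set.Ioo_subset_Ico_self ht)
  have hsm : ContDiffOn ℝ ∞ (fun p : ℝ × ℝ => γ p.1 p.2) (slab T) := h.smooth
  have hre : ContDiffOn ℝ ∞ (fun p : ℝ × ℝ => (γ p.1 p.2).re) (slab T) :=
    Complex.reCLM.contDiff.comp_contDiffOn hsm
  have him : ContDiffOn ℝ ∞ (fun p : ℝ × ℝ => (γ p.1 p.2).im) (slab T) :=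
    Complex.imCLM.contDiff.comp_contDiffOn hsm
  set X : smoothFun T := ofContDiffOn _ hre with hXdef
  set Y : smoothFun T := ofContDiffOn _ him with hYdef
  have hγ : ∀ t ∈ Set.Ioo 0 T, ∀ x ∈ paramInterval, γ t x = ⟨ext X (t, x), ext Y (t, x)⟩ := by
    intro t ht x hx
    have hp : (t, x) ∈ slab T := ⟨ht, hx⟩
    rw [hXdef, hYdef, ext_ofContDiffOn _ hp, ext_ofContDiffOn _ hp]
  have hγx : ∀ t ∈ Set.Ioo 0 T, ∀ x ∈ paramInterval,
      paramDeriv (γ t) x = ⟨ext (spaceDeriv X) (t, x), ext (spaceDeriv Y) (t, x)⟩ :=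
    fun t ht x hx => paramDeriv_complex_eq ht (hγ t ht) hx
  set V : smoothFun T := spaceDeriv X ^ 2 + spaceDeriv Y ^ 2 with hV
  have hVpos : ∀ p ∈ slab T, 0 < ext V p := by
    rintro ⟨t, x⟩ hp
    have h1 := hreg t hp.1 x hp.2
    rw [hγx t hp.1 x hp.2, Ne, Complex.ext_iff] at h1
    rw [hV, ext_add, ext_pow _ hp, ext_pow _ hp]
    by_contra! h2
    refine h1 ⟨?_, ?_⟩
    · show ext (spaceDeriv X) (t, x) = 0
      nlinarith [sq_nonneg (ext (spaceDeriv X) (t, x)), sq_nonneg (ext (spaceDeriv Y) (t, x))]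
    · show ext (spaceDeriv Y) (t, x) = 0
      nlinarith [sq_nonneg (ext (spaceDeriv X) (t, x)), sq_nonneg (ext (spaceDeriv Y) (t, x))]
  set v : smoothFun T := ofContDiffOn (fun p => Real.sqrt (ext V p))
    ((contDiffOn_ext V).sqrt fun p hp => (hVpos p hp).ne') with hvdef
  have hv : ∀ p ∈ slab T, ext v p = Real.sqrt (ext V p) := fun p hp => ext_ofContDiffOn _ hp
  have hvpos : ∀ p ∈ slab T, 0 < ext v p := fun p hp => by
    rw [hv p hp]; exact Real.sqrt_pos.2 (hVpos p hp)
  set w : smoothFun T := ofContDiffOn (fun p => (ext v p)⁻¹)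
    ((contDiffOn_ext v).inv fun p hp => (hvpos p hp).ne') with hwdef
  have hw : ∀ p ∈ slab T, ext w p = (ext v p)⁻¹ := fun p hp => ext_ofContDiffOn _ hp
  have hwv : w * v = 1 := smoothFun_eq fun p hp => by
    rw [ext_mul, hw p hp, ext_one hp, inv_mul_cancel₀ (hvpos p hp).ne']
  have hvv : v ^ 2 = V := smoothFun_eq fun p hp => by
    rw [ext_pow _ hp, hv p hp, Real.sq_sqrt (hVpos p hp).le]
  have hspeed : ∀ t ∈ Set.Ioo 0 T, ∀ x ∈ paramInterval, ‖paramDeriv (γ t) x‖ = ext v (t, x) := by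
    intro t ht x hx
    have hp : (t, x) ∈ slab T := ⟨ht, hx⟩
    rw [hγx t ht x hx, hv _ hp, hV, ext_add, ext_pow _ hp, ext_pow _ hp, Complex.norm_def,
      Complex.normSq_mk, pow_two, pow_two]
  have hspeed' : ∀ t ∈ Set.Ioo 0 T, ∀ x ∈ paramInterval,
      ‖paramDeriv (γ t) x‖⁻¹ = ext w (t, x) := fun t ht x hx => by
    rw [hspeed t ht x hx, hw _ ⟨ht, hx⟩]
  -- Removes the factor 2 that differentiating a sum of squares produces.
  have cancel : ∀ f : smoothFun T, f + f = 0 → f = 0 := fun f hf => smoothFun_eq fun p _ => by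
    have := congrArg (fun g => ext g p) hf
    simp only [ext_add, ext_zero] at this ⊢
    linarith
  set D : Derivation ℝ (smoothFun T) (smoothFun T) := arcDerivation w with hD
  have hDapp : ∀ f, D f = w * spaceDeriv f := fun f => rfl
  set k : smoothFun T := D (D Y) * D X - D (D X) * D Y with hk
  have hu : D X ^ 2 + D Y ^ 2 = 1 := by
    rw [hDapp, hDapp]
    linear_combination (-w ^ 2) * hvv + (w * v + 1) * hwv - w ^ 2 * hV
  have hu' : D X * D (D X) + D Y * D (D Y) = 0 := by
    apply cancel
    have := congrArg D hu
    simp only [pow_two, map_add, Derivation.leibniz, smul_eq_mul, D.map_one_eq_zero] at this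
    linear_combination this
  -- Frenet: τ_s is orthogonal to the unit vector τ, hence τ_s = k ν.
  have hXX : D (D X) = -(k * D Y) := by
    linear_combination (-D (D X)) * hu + D X * hu' - D Y * hk
  have hYY : D (D Y) = k * D X := by
    linear_combination (-D (D Y)) * hu + D Y * hu' + D X * hk
  have htan : ∀ t ∈ Set.Ioo 0 T, ∀ x ∈ paramInterval,
      tangent (γ t) x = ⟨ext (D X) (t, x), ext (D Y) (t, x)⟩ := fun t ht x hx =>
    arcDeriv_complex_eq ht (hspeed' t ht) (hγ t ht) hx
  have hnor : ∀ t ∈ Set.Ioo 0 T, ∀ x ∈ paramInterval,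
      normal (γ t) x = ⟨-ext (D Y) (t, x), ext (D X) (t, x)⟩ := fun t ht x hx => by
    rw [normal, htan t ht x hx]
    apply Complex.ext <;> simp
  have hcurv : ∀ t ∈ Set.Ioo 0 T, ∀ x ∈ paramInterval, curvature (γ t) x = ext k (t, x) := by
    intro t ht x hx
    have h2 : arcDeriv (γ t) (tangent (γ t)) x =
        ⟨ext (D (D X)) (t, x), ext (D (D Y)) (t, x)⟩ :=
      arcDeriv_complex_eq ht (hspeed' t ht) (htan t ht) hx
    rw [curvature, h2, hnor t ht x hx]
    simp only [Complex.inner, hk, ext_sub, ext_mul]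
    simp
    ring
  have hcurvD : ∀ t ∈ Set.Ioo 0 T, ∀ j, ∀ x ∈ paramInterval,
      curvatureDeriv (γ t) j x = ext (D^[j] k) (t, x) := fun t ht j x hx =>
    arcDeriv_iterate_eq ht (hspeed' t ht) (hcurv t ht) j hx
  obtain ⟨F, hF⟩ : ∃ F : smoothFun T, F = -((-1 : ℝ) ^ m • D^[2 * m + 2] k
        + ∑ j ∈ Finset.Icc 1 m, (-1 : ℝ) ^ j • (k * D^[m + j] k * D^[m - j] k)
        + (1 / 2 : ℝ) • (k * D^[m] k ^ 2)) := ⟨_, rfl⟩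
  have hgrad : ∀ t ∈ Set.Ioo 0 T, ∀ x ∈ paramInterval,
      gradSpeed m (γ t) x = ext F (t, x) := by
    intro t ht x hx
    simp only [gradSpeed, hcurvD t ht _ x hx, hcurv t ht x hx, hF, ext_neg, ext_add, ext_smul,
      ext_sum, ext_mul, ext_pow _ (show (t, x) ∈ slab T from ⟨ht, hx⟩)]
    ring
  have hflow : ∀ t ∈ Set.Ioo 0 T, ∀ x ∈ paramInterval,
      HasDerivAt (fun τ => γ τ x) (⟨-(ext F (t, x) * ext (D Y) (t, x)),
        ext F (t, x) * ext (D X) (t, x)⟩ : ℂ) t := by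
    intro t ht x hx
    convert h.flow t ht x hx using 1
    rw [hgrad t ht x hx, hnor t ht x hx]
    apply Complex.ext <;> simp
  have hloc : ∀ t ∈ Set.Ioo 0 T, ∀ x ∈ paramInterval, ∀ᶠ τ in nhds t,
      γ τ x = ⟨ext X (τ, x), ext Y (τ, x)⟩ := fun t ht x hx => by
    filter_upwards [Ioo_mem_nhds ht.1 ht.2] with τ hτ using hγ τ hτ x hx
  have hX : timeDeriv X = -(F * D Y) := smoothFun_eq fun p hp => by
    obtain ⟨t, x⟩ := p
    rw [ext_neg, ext_mul]
    refine (hasDerivAt_time X hp.1 hp.2).unique ?_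
    refine (Complex.reCLM.hasFDerivAt.comp_hasDerivAt t (hflow t hp.1 x hp.2)).congr_of_eventuallyEq
      ?_
    filter_upwards [hloc t hp.1 x hp.2] with τ hτ
    simp [hτ]
  have hY : timeDeriv Y = F * D X := smoothFun_eq fun p hp => by
    obtain ⟨t, x⟩ := p
    rw [ext_mul]
    refine (hasDerivAt_time Y hp.1 hp.2).unique ?_
    refine (Complex.imCLM.hasFDerivAt.comp_hasDerivAt t (hflow t hp.1 x hp.2)).congr_of_eventuallyEq
      ?_
    filter_upwards [hloc t hp.1 x hp.2] with τ hτ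
    simp [hτ]
  have hcomm : ∀ f : smoothFun T, timeDeriv (spaceDeriv f) = spaceDeriv (timeDeriv f) :=
    dirDeriv_comm _ _
  have hPv : timeDeriv v = -(k * F * v) := by
    refine speed_evolution hcomm hwv ?_ hk hX hY
    have h1 := congrArg timeDeriv hvv
    rw [hV] at h1
    simp only [pow_two, map_add, Derivation.leibniz, smul_eq_mul] at h1
    rw [← sub_eq_zero]
    apply cancel
    linear_combination h1
  have hc : ∀ f, timeDeriv (D f) = D (timeDeriv f) + k * F * D f := commutator hcomm hwv hPv
  -- Differentiating ⟨ν, e⟩ = 0 in time gives F_s ⟨τ, e⟩ = 0 at the ends. There ⟨τ, e⟩² = 1, because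
  -- τ, ν is an orthonormal frame and `e` is a unit vector.
  have hDF : D F ∈ endIdeal T := by
    obtain ⟨h1, h2⟩ := tangent_evolution hc hX hY hXX hYY
    have hg : e.im • D X - e.re • D Y ∈ endIdeal T := by
      intro t ht x hx
      have h3 := h.neumann t (Set.Ioo_subset_Ico_self ht) x hx
      rw [hnor t ht x (ends_subset hx)] at h3
      simp only [Complex.inner, ext_sub, ext_smul] at h3 ⊢
      simp at h3
      linarith
    have hPg := timeDeriv_mem_endIdeal hg
    rw [map_sub, Derivation.map_smul, Derivation.map_smul, h1, h2] at hPg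
    intro t ht x hx
    have g1 := hg t ht x hx
    have g2 := hPg t ht x hx
    have g3 := congrArg (fun f => ext f (t, x)) hu
    have hp : (t, x) ∈ slab T := ⟨ht, ends_subset hx⟩
    simp only [ext_sub, ext_smul, ext_neg, ext_mul, ext_add, ext_pow _ hp, ext_one hp] at g1 g2 g3
    have g4 : e.re ^ 2 + e.im ^ 2 = 1 := by
      have := Complex.sq_norm e
      rw [h.norm_e, Complex.normSq_apply] at this
      linarith
    set p := ext (D X) (t, x)
    set q := ext (D Y) (t, x)
    set r := ext (D F) (t, x)
    linear_combination (-(r * (e.re ^ 2 + e.im ^ 2))) * g3 - r * g4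
      - (e.re * p + e.im * q) * g2 + r * (e.im * p - e.re * q) * g1
  exact ⟨v, w, k, F, hwv, hvpos, hspeed, hcurvD, hF, hPv, hc,
    curvature_evolution hc hX hY hu hk hXX hYY, hDF, fun i hi t ht x hx => by
      rw [← hcurvD t ht _ x (ends_subset hx)]
      exact h.odd_curvature t (Set.Ioo_subset_Ico_self ht) x hx i hi⟩

end PlaneCurve

end

noncomputable section
namespace PlaneCurve

/-! ### Joint continuity of parameter derivatives down to the initial time. -/

section JointContinuity

variable {E F : Type*} [NormedAddCommGroup E] [NormedSpace ℝ E] [NormedAddCommGroup F]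
  [NormedSpace ℝ F]

/-- The parameter derivatives of `f t` of order at most `n` exist and are jointly continuous in
`(t, x)`, for `t ∈ [0, T)`. -/
def SpaceContDiff (T : ℝ) {E : Type*} [NormedAddCommGroup E] [NormedSpace ℝ E] :
    ℕ → (ℝ → ℝ → E) → Prop
  | 0, f => ContinuousOn (fun p : ℝ × ℝ => f p.1 p.2) (Set.Ico 0 T ×ˢ paramInterval)
  | n + 1, f => ContinuousOn (fun p : ℝ × ℝ => f p.1 p.2) (Set.Ico 0 T ×ˢ paramInterval) ∧
      (∀ t ∈ Set.Ico 0 T, DifferentiableOn ℝ (f t) paramInterval) ∧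
      SpaceContDiff T n (fun t => paramDeriv (f t))

variable {T : ℝ} {n : ℕ} {f g : ℝ → ℝ → E}

theorem SpaceContDiff.continuousOn (h : SpaceContDiff T n f) :
    ContinuousOn (fun p : ℝ × ℝ => f p.1 p.2) (Set.Ico 0 T ×ˢ paramInterval) := by
  cases n with
  | zero => exact h
  | succ n => exact h.1

theorem SpaceContDiff.hasDerivWithinAt (h : SpaceContDiff T (n + 1) f) {t x : ℝ}
    (ht : t ∈ Set.Ico 0 T) (hx : x ∈ paramInterval) :
    HasDerivWithinAt (f t) (paramDeriv (f t) x) paramInterval x :=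
  (h.2.1 t ht x hx).hasDerivWithinAt

theorem SpaceContDiff.congr (h : SpaceContDiff T n f)
    (hfg : ∀ t ∈ Set.Ico 0 T, ∀ x ∈ paramInterval, g t x = f t x) : SpaceContDiff T n g := by
  induction n generalizing f g with
  | zero => exact ContinuousOn.congr h fun p hp => hfg p.1 hp.1 p.2 hp.2
  | succ n ih =>
    refine ⟨h.1.congr fun p hp => hfg p.1 hp.1 p.2 hp.2,
      fun t ht => (h.2.1 t ht).congr (hfg t ht), ih h.2.2 fun t ht x hx => ?_⟩
    exact derivWithin_congr (hfg t ht) (hfg t ht x hx)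

/-- Joint continuity of the derivatives, from a formula for the derivative. -/
theorem SpaceContDiff.of_hasDerivWithinAt
    (hf : ContinuousOn (fun p : ℝ × ℝ => f p.1 p.2) (Set.Ico 0 T ×ˢ paramInterval))
    (hd : ∀ t ∈ Set.Ico 0 T, ∀ x ∈ paramInterval,
      HasDerivWithinAt (f t) (g t x) paramInterval x) (hg : SpaceContDiff T n g) :
    SpaceContDiff T (n + 1) f :=
  ⟨hf, fun t ht x hx => (hd t ht x hx).differentiableWithinAt, hg.congr fun t ht x hx =>
    (hd t ht x hx).derivWithin (uniqueDiffOn_paramInterval x hx)⟩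

theorem SpaceContDiff.of_succ (h : SpaceContDiff T (n + 1) f) : SpaceContDiff T n f := by
  induction n generalizing f with
  | zero => exact h.1
  | succ n ih => exact ⟨h.1, h.2.1, ih h.2.2⟩

theorem SpaceContDiff.add (hf : SpaceContDiff T n f) (hg : SpaceContDiff T n g) :
    SpaceContDiff T n (fun t x => f t x + g t x) := by
  induction n generalizing f g with
  | zero => exact ContinuousOn.add hf hg
  | succ n ih =>
    exact .of_hasDerivWithinAt (hf.continuousOn.add hg.continuousOn)
      (fun t ht x hx => (hf.hasDerivWithinAt ht hx).add (hg.hasDerivWithinAt ht hx))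
      (ih hf.2.2 hg.2.2)

theorem SpaceContDiff.smul {r : ℝ → ℝ → ℝ} (hr : SpaceContDiff T n r)
    (hf : SpaceContDiff T n f) : SpaceContDiff T n (fun t x => r t x • f t x) := by
  induction n generalizing f r with
  | zero => exact ContinuousOn.smul hr hf
  | succ n ih =>
    exact .of_hasDerivWithinAt (hr.continuousOn.smul hf.continuousOn)
      (fun t ht x hx => (hr.hasDerivWithinAt ht hx).smul (hf.hasDerivWithinAt ht hx))
      ((ih hr.of_succ hf.2.2).add (ih hr.2.2 hf.of_succ))

theorem SpaceContDiff.mul {f g : ℝ → ℝ → ℝ} (hf : SpaceContDiff T n f)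
    (hg : SpaceContDiff T n g) : SpaceContDiff T n (fun t x => f t x * g t x) :=
  hf.smul hg

theorem SpaceContDiff.clm (L : E →L[ℝ] F) (hf : SpaceContDiff T n f) :
    SpaceContDiff T n (fun t x => L (f t x)) := by
  induction n generalizing f with
  | zero => exact L.continuous.comp_continuousOn hf
  | succ n ih =>
    exact .of_hasDerivWithinAt (L.continuous.comp_continuousOn hf.continuousOn)
      (fun t ht x hx => L.hasFDerivAt.comp_hasDerivWithinAt x (hf.hasDerivWithinAt ht hx))
      (ih hf.2.2)

theorem SpaceContDiff.const_mul {f : ℝ → ℝ → ℝ} (c : ℝ) (hf : SpaceContDiff T n f) :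
    SpaceContDiff T n (fun t x => c * f t x) :=
  hf.clm (c • ContinuousLinearMap.id ℝ ℝ)

/-- The derivative of f^{-1/2} is -(1/2) f' (f^{-1/2})³, a polynomial in f' and the function itself,
so induction on the order closes. -/
theorem SpaceContDiff.inv_sqrt {f : ℝ → ℝ → ℝ} (hf : SpaceContDiff T n f)
    (hpos : ∀ t ∈ Set.Ico 0 T, ∀ x ∈ paramInterval, 0 < f t x) :
    SpaceContDiff T n (fun t x => (√(f t x))⁻¹) := by
  have hc : ContinuousOn (fun p : ℝ × ℝ => (√(f p.1 p.2))⁻¹) (Set.Ico 0 T ×ˢ paramInterval) :=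
    (hf.continuousOn.sqrt).inv₀ fun p hp => (Real.sqrt_pos.2 (hpos p.1 hp.1 p.2 hp.2)).ne'
  induction n with
  | zero => exact hc
  | succ n ih =>
    have hi := ih hf.of_succ
    refine .of_hasDerivWithinAt hc (g := fun t x => -(1 / 2) * (paramDeriv (f t) x *
      ((√(f t x))⁻¹ * ((√(f t x))⁻¹ * (√(f t x))⁻¹)))) (fun t ht x hx => ?_)
      ((hf.2.2.mul (hi.mul (hi.mul hi))).const_mul _)
    have h0 := hpos t ht x hx
    have hs : √(f t x) ≠ 0 := (Real.sqrt_pos.2 h0).ne'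
    refine (((hf.hasDerivWithinAt ht hx).sqrt h0.ne').inv hs).congr_deriv ?_
    field_simp

theorem SpaceContDiff.of_iteratedDerivWithin
    (hs : ∀ t ∈ Set.Ico 0 T, ContDiffOn ℝ ∞ (f t) paramInterval)
    (h : ∀ j ≤ n, ContinuousOn (fun p : ℝ × ℝ => iteratedDerivWithin j (f p.1) paramInterval p.2)
      (Set.Ico 0 T ×ˢ paramInterval)) : SpaceContDiff T n f := by
  induction n generalizing f with
  | zero => simpa [SpaceContDiff] using h 0 le_rfl
  | succ n ih =>
    refine ⟨by simpa using h 0 (Nat.zero_le _), fun t ht => (hs t ht).differentiableOn (by simp),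
      ih (fun t ht => (hs t ht).derivWithin uniqueDiffOn_paramInterval (by simp)) fun j hj => ?_⟩
    refine (h (j + 1) (by omega)).congr fun p hp => ?_
    exact (congrFun iteratedDerivWithin_succ' p.2).symm

/-- Dominated convergence, with a constant bound from compactness of [0, s] × [-1, 1] for some s
between t and T. -/
theorem SpaceContDiff.continuousOn_integral {f : ℝ → ℝ → ℝ} (hf : SpaceContDiff T n f) :
    ContinuousOn (fun t => ∫ x in (-1 : ℝ)..1, f t x) (Set.Ico 0 T) := by
  intro t ht
  have hc := hf.continuousOn
  obtain ⟨s, hts, hsT⟩ := exists_between ht.2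
  have hsub : Set.Icc 0 s ⊆ Set.Ico 0 T := fun τ hτ => ⟨hτ.1, hτ.2.trans_lt hsT⟩
  obtain ⟨M, hM⟩ := (isCompact_Icc.prod isCompact_Icc).exists_bound_of_continuousOn
    (hc.mono (Set.prod_mono hsub (subset_refl paramInterval)))
  have hev : ∀ᶠ τ in nhdsWithin t (Set.Ico 0 T), τ ∈ Set.Icc 0 s := by
    filter_upwards [self_mem_nhdsWithin, mem_nhdsWithin_of_mem_nhds (Iio_mem_nhds hts)] with τ h1 h2
      using ⟨h1.1, le_of_lt h2⟩
  have hmem : ∀ x ∈ Set.uIoc (-1 : ℝ) 1, x ∈ paramInterval := fun x hx => by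
    rw [← uIcc_eq_paramInterval]; exact Set.uIoc_subset_uIcc hx
  refine intervalIntegral.continuousWithinAt_of_dominated_interval (bound := fun _ => M) ?_ ?_ ?_ ?_
  · filter_upwards [hev] with τ hτ
    have hτc : ContinuousOn (f τ) paramInterval :=
      hc.comp (f := fun x : ℝ => (τ, x)) (by fun_prop) fun x hx => ⟨hsub hτ, hx⟩
    exact (intervalIntegrable_of_continuousOn_paramInterval hτc).def'.aestronglyMeasurable
  · filter_upwards [hev] with τ hτ
    exact Filter.Eventually.of_forall fun x hx => hM (τ, x) ⟨hτ, hmem x hx⟩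
  · exact intervalIntegrable_const
  · refine Filter.Eventually.of_forall fun x hx => ?_
    have : ContinuousOn (fun τ => f τ x) (Set.Ico 0 T) :=
      hc.comp (f := fun τ : ℝ => (τ, x)) (by fun_prop) fun τ hτ => ⟨hτ, hmem x hx⟩
    exact this t ht

end JointContinuity

/-! ### Continuity of the geometric integrals at the initial time. -/

section FlowContinuity

variable {m : ℕ} {e : ℂ} {a b T : ℝ} {γ : ℝ → ℝ → ℂ}

theorem IsGradientFlow.spaceContDiff (h : IsGradientFlow m e a b T γ) :
    SpaceContDiff T (m + 2) γ := by
  refine .of_iteratedDerivWithin (fun t ht => ?_) h.attains_initial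
  rcases ht.1.eq_or_lt with rfl | h0
  · exact h.smooth_initial
  · exact h.smooth.comp (f := fun x : ℝ => (t, x)) (by fun_prop) fun x hx => ⟨⟨h0, ht.2⟩, hx⟩

theorem norm_eq_sqrt (z : ℂ) : ‖z‖ = √(Complex.reCLM z * Complex.reCLM z +
    Complex.imCLM z * Complex.imCLM z) := by
  rw [Complex.norm_def, Complex.normSq_apply]; rfl

theorem IsGradientFlow.spaceContDiff_inv_speed (h : IsGradientFlow m e a b T γ) :
    SpaceContDiff T (m + 1) (fun t x => ‖paramDeriv (γ t) x‖⁻¹) := by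
  have h1 := h.spaceContDiff.2.2
  have h2 := ((h1.clm Complex.reCLM).mul (h1.clm Complex.reCLM)).add
    ((h1.clm Complex.imCLM).mul (h1.clm Complex.imCLM))
  refine (h2.inv_sqrt fun t ht x hx => ?_).congr fun t ht x hx => by rw [norm_eq_sqrt]
  have := norm_pos_iff.2 (h.regular t ht x hx)
  rw [norm_eq_sqrt] at this
  exact Real.sqrt_pos.1 this

theorem IsGradientFlow.spaceContDiff_arcDeriv {E : Type*} [NormedAddCommGroup E] [NormedSpace ℝ E]
    (h : IsGradientFlow m e a b T γ) {n : ℕ} (hn : n ≤ m + 1) {f : ℝ → ℝ → E}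
    (hf : SpaceContDiff T (n + 1) f) :
    SpaceContDiff T n (fun t => arcDeriv (γ t) (f t)) :=
  (Nat.decreasingInduction (motive := fun n _ => SpaceContDiff T n _)
    (fun _ _ => SpaceContDiff.of_succ) h.spaceContDiff_inv_speed hn).smul hf.2.2

theorem IsGradientFlow.spaceContDiff_curvature (h : IsGradientFlow m e a b T γ) :
    SpaceContDiff T m (fun t => curvature (γ t)) := by
  have h1 : SpaceContDiff T (m + 1) (fun t => tangent (γ t)) :=
    h.spaceContDiff_arcDeriv le_rfl h.spaceContDiff
  have h2 := h.spaceContDiff_arcDeriv (Nat.le_succ m) h1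
  have h3 := h1.of_succ
  refine (((h2.clm Complex.imCLM).mul (h3.clm Complex.reCLM)).add
    (((h2.clm Complex.reCLM).mul (h3.clm Complex.imCLM)).const_mul (-1))).congr
      fun t ht x hx => ?_
  simp [curvature, normal, Complex.inner]
  ring

/-- Curvature uses two of the `m + 2` derivatives and each ∂_s one more. At `j = m` none is left,
but the energy integrand is still continuous up to t = 0. -/
theorem IsGradientFlow.spaceContDiff_curvatureDeriv (h : IsGradientFlow m e a b T γ) {n j : ℕ}
    (hnj : n + j = m) : SpaceContDiff T n (fun t => curvatureDeriv (γ t) j) := by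
  induction j generalizing n with
  | zero => obtain rfl : n = m := hnj; exact h.spaceContDiff_curvature
  | succ j ih =>
    refine (h.spaceContDiff_arcDeriv (by omega) (ih (n := n + 1) (by omega))).congr
      fun t ht x hx => ?_
    rw [curvatureDeriv, Function.iterate_succ_apply']
    rfl

theorem IsGradientFlow.continuousOn_arcIntegral (h : IsGradientFlow m e a b T γ) {n : ℕ}
    {f : ℝ → ℝ → ℝ} (hf : SpaceContDiff T n f) :
    ContinuousOn (fun t => arcIntegral (γ t) (f t)) (Set.Ico 0 T) := by
  have h1 : SpaceContDiff T 0 (fun t x => f t x * ‖paramDeriv (γ t) x‖) :=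
    hf.continuousOn.mul h.spaceContDiff.2.2.continuousOn.norm
  exact h1.continuousOn_integral

end FlowContinuity

end PlaneCurve

end

/-! ### The continuity argument and the conclusion. -/

noncomputable section
namespace PlaneCurve

/-- A continuous function on `[0, s]` with nonpositive derivative inside is antitone. -/
theorem antitoneOn_Icc_of_hasDerivAt_nonpos {f : ℝ → ℝ} {s : ℝ}
    (hc : ContinuousOn f (Set.Icc 0 s))
    (hd : ∀ t ∈ Set.Ioo 0 s, ∃ d ≤ 0, HasDerivAt f d t) : AntitoneOn f (Set.Icc 0 s) := by
  refine antitoneOn_of_deriv_nonpos (convex_Icc 0 s) hc ?_ ?_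
  · rw [interior_Icc]
    intro t ht
    obtain ⟨d, -, h⟩ := hd t ht
    exact h.differentiableAt.differentiableWithinAt
  · rw [interior_Icc]
    intro t ht
    obtain ⟨d, h0, h⟩ := hd t ht
    rwa [h.deriv]

/-- If the energy decreases, and the length decreases as long as `C L^n E ≤ 1`, then the length
decreases for all time as soon as `2 C L^n E ≤ 1` initially. -/
theorem antitoneOn_of_small {L E : ℝ → ℝ} {T C : ℝ} {n : ℕ} (hC : 0 < C)
    (hL : ContinuousOn L (Set.Ico 0 T)) (hE : ContinuousOn E (Set.Ico 0 T))
    (hL0 : ∀ t ∈ Set.Ico 0 T, 0 ≤ L t) (hE0 : ∀ t ∈ Set.Ico 0 T, 0 ≤ E t)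
    (hEd : ∀ t ∈ Set.Ioo 0 T, ∃ d ≤ 0, HasDerivAt E d t)
    (hLd : ∀ t ∈ Set.Ioo 0 T, C * (L t ^ n * E t) ≤ 1 → ∃ d ≤ 0, HasDerivAt L d t)
    (h0 : L 0 ^ n * E 0 ≤ 1 / (2 * C)) : AntitoneOn L (Set.Ico 0 T) := by
  have hsub : ∀ s < T, Set.Icc 0 s ⊆ Set.Ico 0 T := fun s hs t ht => ⟨ht.1, ht.2.trans_lt hs⟩
  have key : ∀ t ∈ Set.Ico 0 T, L t ^ n * E t < 1 / C := by
    intro t₁ ht₁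
    by_contra! hbig
    have hΦ : ContinuousOn (fun t => L t ^ n * E t) (Set.Icc 0 t₁) :=
      ((hL.pow n).mul hE).mono (hsub t₁ ht₁.2)
    have hcl : IsCompact (Set.Icc 0 t₁ ∩ (fun t => L t ^ n * E t) ⁻¹' Set.Ici (1 / C)) :=
      isCompact_Icc.of_isClosed_subset (hΦ.preimage_isClosed_of_isClosed isClosed_Icc isClosed_Ici)
        Set.inter_subset_left
    -- At the first bad time `s`, L and E have decreased on [0, s], so the product is still at most
    -- `1 / (2 * C)`, below the threshold `1 / C`.
    obtain ⟨s, ⟨hs, hsΦ⟩, hleast⟩ := hcl.exists_isLeast ⟨t₁, ⟨ht₁.1, le_rfl⟩, hbig⟩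
    have hsT : s < T := hs.2.trans_lt ht₁.2
    have hsm : s ∈ Set.Icc 0 s := ⟨hs.1, le_rfl⟩
    have h0m : (0 : ℝ) ∈ Set.Icc 0 s := ⟨le_rfl, hs.1⟩
    have hLa : AntitoneOn L (Set.Icc 0 s) := by
      refine antitoneOn_Icc_of_hasDerivAt_nonpos (hL.mono (hsub s hsT)) fun t ht =>
        hLd t ⟨ht.1, ht.2.trans hsT⟩ ?_
      have : L t ^ n * E t < 1 / C := by
        by_contra! h
        exact ht.2.not_ge (hleast ⟨⟨ht.1.le, ht.2.le.trans hs.2⟩, h⟩)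
      rw [lt_div_iff₀ hC] at this
      linarith
    have hEa : AntitoneOn E (Set.Icc 0 s) :=
      antitoneOn_Icc_of_hasDerivAt_nonpos (hE.mono (hsub s hsT)) fun t ht =>
        hEd t ⟨ht.1, ht.2.trans hsT⟩
    have h1 : L s ^ n * E s ≤ L 0 ^ n * E 0 :=
      mul_le_mul (pow_le_pow_left₀ (hL0 s (hsub s hsT hsm)) (hLa h0m hsm hs.1) n)
        (hEa h0m hsm hs.1) (hE0 s (hsub s hsT hsm)) (pow_nonneg (hL0 0 (hsub s hsT h0m)) n)
    have h2 : 1 / C ≤ 1 / (2 * C) := (Set.mem_preimage.1 hsΦ).trans (h1.trans h0)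
    rw [div_le_div_iff₀ hC (by positivity)] at h2
    linarith
  intro t₁ ht₁ t₂ ht₂ h12
  refine antitoneOn_Icc_of_hasDerivAt_nonpos (hL.mono (hsub t₂ ht₂.2)) (fun t ht => ?_)
    ⟨ht₁.1, h12⟩ ⟨ht₂.1, le_rfl⟩ h12
  have ht' : t ∈ Set.Ioo 0 T := ⟨ht.1, ht.2.trans ht₂.2⟩
  refine hLd t ht' ?_
  have := key t (Set.Ioo_subset_Ico_self ht')
  rw [lt_div_iff₀ hC] at this
  linarith

theorem length_nonneg (c : ℝ → ℂ) : 0 ≤ length c :=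
  intervalIntegral.integral_nonneg (by norm_num) fun x _ => by positivity

theorem energy_nonneg (m : ℕ) (c : ℝ → ℂ) : 0 ≤ energy m c :=
  intervalIntegral.integral_nonneg (by norm_num) fun x _ => by positivity

theorem HasDerivAt.congr_Ioo {f g : ℝ → ℝ} {d t T : ℝ} (h : HasDerivAt f d t)
    (ht : t ∈ Set.Ioo 0 T) (hfg : ∀ τ ∈ Set.Ioo 0 T, g τ = f τ) : HasDerivAt g d t := by
  refine h.congr_of_eventuallyEq ?_
  filter_upwards [Ioo_mem_nhds ht.1 ht.2] with τ hτ using hfg τ hτ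

theorem IsGradientFlow.antitoneOn_length {m : ℕ} {e : ℂ} {a b T : ℝ} {γ : ℝ → ℝ → ℂ}
    (h : IsGradientFlow m e a b T γ) (hw0 : windingNumber (γ 0) = 0)
    (hsmall : length (γ 0) ^ (2 * m + 1) * energy m (γ 0) ≤ 1 / (2 * lengthConst m)) :
    AntitoneOn (fun t => length (γ t)) (Set.Ico 0 T) := by
  obtain ⟨v, w, k, F, hwv, hvpos, hspeed, hcurv, hF, hPv, hc, hPk, hDF, hk⟩ := h.exists_smoothFun
  have hlen : ∀ t ∈ Set.Ioo 0 T,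
      length (γ t) = ∫ x in (-1 : ℝ)..1, ext 1 (t, x) * ext v (t, x) := fun t ht =>
    arcIntegral_eq (hspeed t ht) fun x hx => (ext_one ⟨ht, hx⟩).symm
  have hen : ∀ t ∈ Set.Ioo 0 T, energy m (γ t) =
      ∫ x in (-1 : ℝ)..1, ext ((arcDerivation w)^[m] k ^ 2) (t, x) * ext v (t, x) := fun t ht =>
    arcIntegral_eq (hspeed t ht) fun x hx => by
      rw [ext_pow _ ⟨ht, hx⟩, hcurv t ht m x hx]
  have hcurvInt : ∀ t ∈ Set.Ioo 0 T, arcIntegral (γ t) (curvature (γ t)) =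
      ∫ x in (-1 : ℝ)..1, ext k (t, x) * ext v (t, x) := fun t ht =>
    arcIntegral_eq (hspeed t ht) fun x hx => hcurv t ht 0 x hx
  have hkC : SpaceContDiff T 0 (fun t => curvature (γ t)) := h.spaceContDiff_curvature.continuousOn
  have hLc : ContinuousOn (fun t => length (γ t)) (Set.Ico 0 T) :=
    h.continuousOn_arcIntegral (n := 0) (f := fun _ _ => 1) continuousOn_const
  have hkm := h.spaceContDiff_curvatureDeriv (zero_add m)
  have hEc : ContinuousOn (fun t => energy m (γ t)) (Set.Ico 0 T) :=
    (h.continuousOn_arcIntegral (hkm.mul hkm)).congr fun t _ => by simp only [energy, pow_two]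
  have hKc := h.continuousOn_arcIntegral hkC
  -- Conservation of the winding number: the time derivative of ∫ k ds is ∫ F_ss ds = 0, and
  -- continuity at t = 0 links it to the initial curve.
  have hK0 : ∀ t (ht : t ∈ Set.Ioo 0 T), sliceIntegral v t ht k = 0 := by
    intro t ht
    have hd : ∀ s ∈ Set.Ioo 0 T,
        HasDerivAt (fun τ => arcIntegral (γ τ) (curvature (γ τ))) 0 s := by
      intro s hs
      refine HasDerivAt.congr_Ioo ?_ hs hcurvInt
      convert hasDerivAt_integral_mul k hPv hs using 1
      rw [hPk, show arcDerivation w (arcDerivation w F) + k ^ 2 * F - k * F * k =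
        arcDerivation w (arcDerivation w F) by ring, sliceIntegral_arcDerivation hwv hs hDF]
    have hsub : Set.Icc 0 t ⊆ Set.Ico 0 T := fun s hs => ⟨hs.1, hs.2.trans_lt ht.2⟩
    have hconst : arcIntegral (γ t) (curvature (γ t)) = arcIntegral (γ 0) (curvature (γ 0)) := by
      obtain ⟨s, -, hd0⟩ := exists_hasDerivAt_eq_slope
        (fun τ => arcIntegral (γ τ) (curvature (γ τ))) (fun _ => 0) ht.1 (hKc.mono hsub)
        fun s hs => hd s ⟨hs.1, hs.2.trans ht.2⟩
      have ht0 : t - 0 ≠ 0 := by simpa using ht.1.ne'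
      exact sub_eq_zero.1 ((div_eq_zero_iff.1 hd0.symm).resolve_right ht0)
    have h00 : arcIntegral (γ 0) (curvature (γ 0)) = 0 := by
      rw [windingNumber] at hw0
      exact (mul_eq_zero.1 hw0).resolve_left (by positivity)
    exact (hcurvInt t ht).symm.trans (hconst.trans h00)
  refine antitoneOn_of_small (E := fun t => energy m (γ t)) (n := 2 * m + 1) (lengthConst_pos m)
    hLc hEc (fun t _ => length_nonneg _) (fun t _ => energy_nonneg _ _) (fun t ht => ?_)
    (fun t ht hs => ?_) hsmall
  · refine ⟨_, ?_, HasDerivAt.congr_Ioo (hasDerivAt_integral_mul _ hPv ht) ht hen⟩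
    rw [energy_variation hc hPk (fun f hf => timeDeriv_mem_endIdeal hf) hDF hk
      fun f hf => sliceIntegral_arcDerivation hwv ht hf]
    -- The gradient expression is `-F`, so the energy has derivative -2 ∫ F² ds.
    rw [← neg_eq_iff_eq_neg.2 hF, mul_neg, map_neg, ← pow_two]
    have := sliceIntegral_sq_nonneg hvpos ht F
    linarith
  · refine ⟨_, ?_, HasDerivAt.congr_Ioo (hasDerivAt_integral_mul 1 hPv ht) ht hlen⟩
    rw [timeDeriv.map_one_eq_zero, mul_one, zero_sub, map_neg, neg_nonpos]
    refine length_variation_bound hwv hvpos ht hk (hK0 t ht) hF ?_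
    rw [hlen t ht, hen t ht] at hs
    exact hs

end PlaneCurve
end

theorem lemma4p3 (m : ℕ) :
    ∃ ε : ℝ, 0 < ε ∧
      ∀ (e : ℂ) (a b T : ℝ) (γ : ℝ → ℝ → ℂ),
        PlaneCurve.IsGradientFlow m e a b T γ →
        PlaneCurve.windingNumber (γ 0) = 0 →
        PlaneCurve.length (γ 0) ^ (2 * m + 1) * PlaneCurve.energy m (γ 0) ≤ ε →
        AntitoneOn (fun t => PlaneCurve.length (γ t)) (Set.Ico 0 T) := by
  have hC := PlaneCurve.lengthConst_pos m
  exact ⟨1 / (2 * PlaneCurve.lengthConst m), by positivity,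
    fun e a b T γ h hw hs => h.antitoneOn_length hw hs⟩
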